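/- Let $n\ge 0$ and let $Y_n=Y(\mathfrak{gl}_n)$ be the Yangian over $\mathbb{C}$: the associative unital $\mathbb{C}$-algebra on generators $T_{i,j}^{(r)}$ ($1\le i,j\le n$, $r\ge 1$) subject to the relations $$(u-v)[T_{i,j}(u),T_{h,k}(v)]=T_{h,j}(u)T_{i,k}(v)-T_{h,j}(v)T_{i,k}(u),$$ where $T_{i,j}(u)=\sum_{r\ge 0}T_{i,j}^{(r)}u^{-r}$ and $T_{i,j}^{(0)}=\delta_{i,j}$. Let $T(u)=(T_{i,j}(u))_{i,j}=F(u)D(u)E(u)$ be the Gauss factorization over $Y_n[[u^{-1}]]$ into a lower unitriangular matrix $F(u)$, a diagonal matrix $D(u)$ and an upper unitriangular matrix $E(u)$. Write $D_i(u)=\sum_{r\ge0}D_i^{(r)}u^{-r}$ for the $i$-th diagonal entry of $D(u)$ and, for $1\le i<j\le n$, $E_{i,j}(u)=\sum_{r\ge1}E_{i,j}^{(r)}u^{-r}$ for the $(i,j)$-entry of $E(u)$ and $F_{i,j}(u)=\sum_{r\ge1}F_{i,j}^{(r)}u^{-r}$ for the $(j,i)$-entry of $F(u)$. Let $Y_{(1^n)}$,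 $Y_{(1^n)}^+$ and $Y_{(1^n)}^-$ be the subalgebras of $Y_n$ generated respectively by all $D_i^{(r)}$ ($1\le i\le n$, $r\ge1$), by all $E_{i,i+1}^{(r)}$, and by all $F_{i,i+1}^{(r)}$ ($1\le i<n$, $r\ge1$). Then, for any choice of a total order on the relevant set of generators: (i) the ordered monomials in $\{D_i^{(r)}\}_{1\le i\le n,\,r\ge1}$ form a basis of $Y_{(1^n)}$; (ii) the ordered monomials in $\{E_{i,j}^{(r)}\}_{1\le i<j\le n,\,r\ge1}$ form a basis of $Y_{(1^n)}^+$; (iii) the ordered monomials in $\{F_{i,j}^{(r)}\}_{1\le i<j\le n,\,r\ge1}$ form a basis of $Y_{(1^n)}^-$; (iv) the ordered monomials in $\{D_i^{(r)}\}_{1\le i\le n,\,r\ge1}\cup\{E_{i,j}^{(r)},F_{i,j}^{(r)}\}_{1\le i<j\le n,\,r\ge1}$ form a basis of $Y_n$. Moreover (triangular decomposition), the multiplication map $Y_{(1^n)}^-\otimes Y_{(1^n)}\otimes Y_{(1^n)}^+\to Y_n$ is an isomorphism of vector spaces. -/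

import Mathlib

open scoped TensorProduct

namespace Yangian

/-! ### The Yangian `Y_n = Y(𝔤𝔩_n)` over `ℂ` -/

/-- The free algebra on letters `T_{i,j}^{(r)}`, `r ≥ 1`. -/
abbrev FreeT (n : ℕ) : Type := FreeAlgebra ℂ (Fin n × Fin n × ℕ+)

/-- The element `T_{i,j}^{(r)}` of the free algebra for `r ≥ 0`, where `T_{i,j}^{(0)} = δ_{i,j}`. -/
noncomputable def freeT (n : ℕ) (i j : Fin n) (r : ℕ) : FreeT n :=
  if hr : 0 < r then FreeAlgebra.ι ℂ (i, j, ⟨r, hr⟩) else if i = j then 1 else 0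

/-- The RTT relations: the coefficient of `u^{-r} v^{-s}` in
`(u - v) [T_{i,j}(u), T_{h,k}(v)] = T_{h,j}(u) T_{i,k}(v) - T_{h,j}(v) T_{i,k}(u)`. -/
inductive Rel (n : ℕ) : FreeT n → FreeT n → Prop
  | rtt (i j h k : Fin n) (r s : ℕ) :
      Rel n (⁅freeT n i j (r + 1), freeT n h k s⁆ - ⁅freeT n i j r, freeT n h k (s + 1)⁆)
        (freeT n h j r * freeT n i k s - freeT n h j s * freeT n i k r)

end Yangian

/-- The Yangian `Y_n`. -/
abbrev Yangian (n : ℕ) : Type := RingQuot (Yangian.Rel n)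

namespace Yangian

/-- `T_{i,j}^{(r)}` in `Y_n`, for `r ≥ 0`. -/
noncomputable def T (n : ℕ) (i j : Fin n) (r : ℕ) : Yangian n :=
  RingQuot.mkAlgHom ℂ (Rel n) (freeT n i j r)

/-- The matrix `T(u)` over `Y_n[[u⁻¹]]`; the variable of the power series is `u⁻¹`. -/
noncomputable def Tser (n : ℕ) : Matrix (Fin n) (Fin n) (PowerSeries (Yangian n)) :=
  Matrix.of fun i j => PowerSeries.mk (T n i j)

/-! ### Gauss factorization -/

section Gauss

variable {R : Type*} [Ring R] {n : ℕ}

/-- The two-sided inverse of a power series with constant coefficient `1`. -/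
noncomputable def invSer (f : PowerSeries R) : PowerSeries R := PowerSeries.invOfUnit f 1

/-- Successive Schur complements. For `k ≤ i, j` (counting from `0`), the entry `(i, j)` of
`schur M k` is the quasi-determinant `|A B; C [M i j]| = M i j - C A⁻¹ B`, where `A` is the leading
`k × k` block of `M`, `B` the first `k` entries of column `j`, `C` those of row `i`. -/
noncomputable def schur (M : Matrix (Fin n) (Fin n) (PowerSeries R)) :
    ℕ → Matrix (Fin n) (Fin n) (PowerSeries R)
  | 0 => M
  | k + 1 => Matrix.of fun i j =>
      if hk : k < n then
        schur M k i j -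
          schur M k i ⟨k, hk⟩ * invSer (schur M k ⟨k, hk⟩ ⟨k, hk⟩) * schur M k ⟨k, hk⟩ j
      else schur M k i j

/-- Diagonal entries of the middle Gauss factor. -/
noncomputable def gaussD (M : Matrix (Fin n) (Fin n) (PowerSeries R)) (i : Fin n) :
    PowerSeries R := schur M i i i

/-- The entry in row `i`, column `j` (`i < j`) of the upper unitriangular Gauss factor. -/
noncomputable def gaussE (M : Matrix (Fin n) (Fin n) (PowerSeries R)) (i j : Fin n) :
    PowerSeries R := invSer (gaussD M i) * schur M i i j

/-- The entry in row `j`, column `i` (`i < j`) of the lower unitriangular Gauss factor. -/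
noncomputable def gaussF (M : Matrix (Fin n) (Fin n) (PowerSeries R)) (i j : Fin n) :
    PowerSeries R := schur M i j i * invSer (gaussD M i)

/-- The diagonal matrix with entries `d`. -/
noncomputable def diagMat (d : Fin n → PowerSeries R) : Matrix (Fin n) (Fin n) (PowerSeries R) :=
  Matrix.diagonal d

/-- The upper unitriangular matrix with entry `e i j` in row `i`, column `j`, for `i < j`. -/
noncomputable def upperMat (e : Fin n → Fin n → PowerSeries R) :
    Matrix (Fin n) (Fin n) (PowerSeries R) :=
  Matrix.of fun i j => if i < j then e i j else if i = j then 1 else 0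

/-- The lower unitriangular matrix with entry `f i j` in row `j`, column `i`, for `i < j`. -/
noncomputable def lowerMat (f : Fin n → Fin n → PowerSeries R) :
    Matrix (Fin n) (Fin n) (PowerSeries R) :=
  Matrix.of fun j i => if i < j then f i j else if i = j then 1 else 0

theorem constantCoeff_schur (M : Matrix (Fin n) (Fin n) (PowerSeries R))
    (hM : ∀ i j, PowerSeries.constantCoeff (M i j) = if i = j then 1 else 0) (k : ℕ)
    (i j : Fin n) :
    PowerSeries.constantCoeff (schur M k i j) = if i = j ∧ k ≤ i.1 then 1 else 0 := by
  induction k generalizing i j with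
  | zero => simp [schur, hM]
  | succ k ih =>
    by_cases hk : k < n
    · have h1 : PowerSeries.constantCoeff
          (invSer (schur M k ⟨k, hk⟩ ⟨k, hk⟩)) = (1 : R) := by
        rw [invSer, PowerSeries.constantCoeff_invOfUnit]; simp
      simp only [schur, Matrix.of_apply, hk, dite_true, map_sub, map_mul, h1, ih]
      rcases i with ⟨i, hi⟩
      rcases j with ⟨j, hj⟩
      simp only [Fin.mk.injEq]
      split_ifs <;> first | omega | simp
    · simp only [schur, Matrix.of_apply, hk, dite_false, ih]
      have := i.2
      split_ifs <;> first | omega | rfl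

theorem invSer_mul_gaussD (M : Matrix (Fin n) (Fin n) (PowerSeries R))
    (hM : ∀ i j, PowerSeries.constantCoeff (M i j) = if i = j then 1 else 0) (i : Fin n) :
    invSer (gaussD M i) * gaussD M i = 1 :=
  PowerSeries.invOfUnit_mul _ _ (by simp [gaussD, constantCoeff_schur M hM])

theorem gaussD_mul_invSer (M : Matrix (Fin n) (Fin n) (PowerSeries R))
    (hM : ∀ i j, PowerSeries.constantCoeff (M i j) = if i = j then 1 else 0) (i : Fin n) :
    gaussD M i * invSer (gaussD M i) = 1 :=
  PowerSeries.mul_invOfUnit _ _ (by simp [gaussD, constantCoeff_schur M hM])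

theorem schur_succ (M : Matrix (Fin n) (Fin n) (PowerSeries R)) (l i j : Fin n) :
    schur M (l.1 + 1) i j =
      schur M l i j - schur M l i l * invSer (gaussD M l) * schur M l l j := by
  simp [schur, gaussD, l.2]

theorem schur_eq_zero (M : Matrix (Fin n) (Fin n) (PowerSeries R))
    (hM : ∀ i j, PowerSeries.constantCoeff (M i j) = if i = j then 1 else 0) (k : ℕ) (hk : k ≤ n)
    (i j : Fin n) (hij : i.1 < k ∨ j.1 < k) : schur M k i j = 0 := by
  induction k generalizing i j with
  | zero => omega
  | succ k ih =>
    have hs := schur_succ M ⟨k, hk⟩ i j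
    simp only at hs
    rw [hs]
    by_cases hik : i.1 < k
    · rw [ih (by omega) i j (Or.inl hik), ih (by omega) i _ (Or.inl hik)]; simp
    by_cases hjk : j.1 < k
    · rw [ih (by omega) i j (Or.inr hjk), ih (by omega) _ j (Or.inr hjk)]; simp
    rcases hij with h | h
    · obtain rfl : i = ⟨k, hk⟩ := Fin.ext (by simp only; omega)
      have := gaussD_mul_invSer M hM ⟨k, hk⟩
      rw [gaussD] at this ⊢
      simp only at this ⊢
      rw [this, one_mul, sub_self]
    · obtain rfl : j = ⟨k, hk⟩ := Fin.ext (by simp only; omega)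
      have := invSer_mul_gaussD M hM ⟨k, hk⟩
      rw [gaussD] at this ⊢
      simp only at this ⊢
      rw [mul_assoc, this, mul_one, sub_self]

theorem eq_sum_add_schur (M : Matrix (Fin n) (Fin n) (PowerSeries R)) (k : ℕ) (hk : k ≤ n)
    (i j : Fin n) :
    M i j = (∑ l : Fin n, if l.1 < k then
      schur M l i l * invSer (gaussD M l) * schur M l l j else 0) + schur M k i j := by
  induction k with
  | zero => simp [schur]
  | succ k ih =>
    have hs := schur_succ M ⟨k, hk⟩ i j
    simp only at hs
    rw [ih (by omega), hs]
    have : ∀ l : Fin n, (if l.1 < k + 1 then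
        schur M l i l * invSer (gaussD M l) * schur M l l j else 0) =
        (if l.1 < k then schur M l i l * invSer (gaussD M l) * schur M l l j else 0) +
        (if l = ⟨k, hk⟩ then schur M l i l * invSer (gaussD M l) * schur M l l j else 0) := by
      intro l
      have : l = ⟨k, hk⟩ ↔ l.1 = k := by simp [Fin.ext_iff]
      simp only [this]
      split_ifs <;> first | omega | simp
    simp only [this, Finset.sum_add_distrib]
    simp

/-- `M = F D E` for a matrix of power series whose constant term is the identity. -/
theorem gauss_factorization (M : Matrix (Fin n) (Fin n) (PowerSeries R))
    (hM : ∀ i j, PowerSeries.constantCoeff (M i j) = if i = j then 1 else 0) :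
    M = lowerMat (gaussF M) * diagMat (gaussD M) * upperMat (gaussE M) := by
  ext1 i j
  rw [eq_sum_add_schur M n le_rfl i j, schur_eq_zero M hM n le_rfl i j (Or.inl i.2), add_zero,
    Matrix.mul_apply]
  refine Finset.sum_congr rfl fun l _ => ?_
  rw [if_pos l.2, diagMat, Matrix.mul_diagonal]
  have hF : lowerMat (gaussF M) i l = schur M l i l * invSer (gaussD M l) := by
    simp only [lowerMat, Matrix.of_apply]
    split_ifs with h1 h2
    · rfl
    · subst h2; exact (gaussD_mul_invSer M hM l).symm
    · rw [schur_eq_zero M hM l l.2.le i l (Or.inl (by omega)), zero_mul]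
  have hE : upperMat (gaussE M) l j = invSer (gaussD M l) * schur M l l j := by
    simp only [upperMat, Matrix.of_apply]
    split_ifs with h1 h2
    · rfl
    · subst h2; exact (invSer_mul_gaussD M hM l).symm
    · rw [schur_eq_zero M hM l l.2.le l j (Or.inr (by omega)), mul_zero]
  rw [hF, hE, mul_assoc (schur M l i l) (invSer (gaussD M l)) (gaussD M l),
    invSer_mul_gaussD M hM, mul_one, mul_assoc]

end Gauss

theorem constantCoeff_Tser (n : ℕ) (i j : Fin n) :
    PowerSeries.constantCoeff (Tser n i j) = if i = j then 1 else 0 := by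
  simp only [Tser, Matrix.of_apply, PowerSeries.constantCoeff_mk, T, freeT, lt_irrefl, dite_false]
  split_ifs <;> simp

/-- The coefficient `D_i^{(r)}` of `u^{-r}` in `D_i(u)`. -/
noncomputable def D (n : ℕ) (i : Fin n) (r : ℕ) : Yangian n :=
  PowerSeries.coeff r (gaussD (Tser n) i)

/-- The coefficient `E_{i,j}^{(r)}` of `u^{-r}` in `E_{i,j}(u)`, for `i < j`. -/
noncomputable def E (n : ℕ) (i j : Fin n) (r : ℕ) : Yangian n :=
  PowerSeries.coeff r (gaussE (Tser n) i j)

/-- The coefficient `F_{i,j}^{(r)}` of `u^{-r}` in `F_{i,j}(u)`, for `i < j`. -/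
noncomputable def F (n : ℕ) (i j : Fin n) (r : ℕ) : Yangian n :=
  PowerSeries.coeff r (gaussF (Tser n) i j)

/-- The elements `D`, `E` and `F` come from the Gauss factorization `T(u) = F(u) D(u) E(u)`. -/
theorem Tser_eq (n : ℕ) :
    Tser n =
      lowerMat (fun i j => PowerSeries.mk (F n i j)) *
        diagMat (fun i => PowerSeries.mk (D n i)) *
        upperMat (fun i j => PowerSeries.mk (E n i j)) := by
  have hF : (fun i j => PowerSeries.mk (F n i j)) = gaussF (Tser n) := by
    funext i j; ext r; simp [F]
  have hD : (fun i => PowerSeries.mk (D n i)) = gaussD (Tser n) := by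
    funext i; ext r; simp [D]
  have hE : (fun i j => PowerSeries.mk (E n i j)) = gaussE (Tser n) := by
    funext i j; ext r; simp [E]
  rw [hF, hD, hE]
  exact gauss_factorization (Tser n) (constantCoeff_Tser n)

/-! ### The subalgebras -/

/-- The Cartan subalgebra `Y_{(1^n)}`, generated by the `D_i^{(r)}`, `r ≥ 1`. -/
noncomputable def cartan (n : ℕ) : Subalgebra ℂ (Yangian n) :=
  Algebra.adjoin ℂ {x | ∃ (i : Fin n) (r : ℕ), 1 ≤ r ∧ x = D n i r}

/-- `Y_{(1^n)}^+`, generated by the `E_i^{(r)} = E_{i,i+1}^{(r)}`, `r ≥ 1`. -/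
noncomputable def plus (n : ℕ) : Subalgebra ℂ (Yangian n) :=
  Algebra.adjoin ℂ {x | ∃ (i j : Fin n) (r : ℕ), j.1 = i.1 + 1 ∧ 1 ≤ r ∧ x = E n i j r}

/-- `Y_{(1^n)}^-`, generated by the `F_i^{(r)} = F_{i,i+1}^{(r)}`, `r ≥ 1`. -/
noncomputable def minus (n : ℕ) : Subalgebra ℂ (Yangian n) :=
  Algebra.adjoin ℂ {x | ∃ (i j : Fin n) (r : ℕ), j.1 = i.1 + 1 ∧ 1 ≤ r ∧ x = F n i j r}

/-- Multiplication `Y_{(1^n)}^- ⊗ Y_{(1^n)} ⊗ Y_{(1^n)}^+ → Y_n`. -/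
noncomputable def triangularMul (n : ℕ) :
    (minus n ⊗[ℂ] cartan n) ⊗[ℂ] plus n →ₗ[ℂ] Yangian n :=
  LinearMap.mul' ℂ (Yangian n) ∘ₗ
    TensorProduct.map
      (LinearMap.mul' ℂ (Yangian n) ∘ₗ
        TensorProduct.map (minus n).val.toLinearMap (cartan n).val.toLinearMap)
      (plus n).val.toLinearMap

theorem triangularMul_tmul (n : ℕ) (f : minus n) (d : cartan n) (e : plus n) :
    triangularMul n ((f ⊗ₜ d) ⊗ₜ e) = (f : Yangian n) * d * e := rfl

/-! ### Ordered monomials -/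

/-- Index set of the `D_i^{(r)}`, `r ≥ 1`. -/
abbrev DIndex (n : ℕ) : Type := Fin n × ℕ+

/-- Index set of the `E_{i,j}^{(r)}`, and of the `F_{i,j}^{(r)}`, for `i < j` and `r ≥ 1`. -/
abbrev RootIndex (n : ℕ) : Type := {p : Fin n × Fin n // p.1 < p.2} × ℕ+

/-- Index set of all the `D_i^{(r)}`, `E_{i,j}^{(r)}` and `F_{i,j}^{(r)}` together. -/
abbrev AllIndex (n : ℕ) : Type := DIndex n ⊕ (RootIndex n ⊕ RootIndex n)

/-- The family of all `D_i^{(r)}`. -/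
noncomputable def dFam (n : ℕ) (a : DIndex n) : Yangian n := D n a.1 a.2

/-- The family of all `E_{i,j}^{(r)}`. -/
noncomputable def eFam (n : ℕ) (a : RootIndex n) : Yangian n := E n a.1.1.1 a.1.1.2 a.2

/-- The family of all `F_{i,j}^{(r)}`. -/
noncomputable def fFam (n : ℕ) (a : RootIndex n) : Yangian n := F n a.1.1.1 a.1.1.2 a.2

/-- The family of all `D_i^{(r)}`, `E_{i,j}^{(r)}` and `F_{i,j}^{(r)}`. -/
noncomputable def allFam (n : ℕ) : AllIndex n → Yangian n :=
  Sum.elim (dFam n) (Sum.elim (eFam n) (fFam n))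

/-- Finite weakly increasing words (repetitions allowed, the empty word included). -/
abbrev OrderedWord {I : Type*} (le : I → I → Prop) : Type _ := {w : List I // w.Pairwise le}

/-- The monomials in the family `x`, with factors taken in the order `le`, form a basis of `S`:
they lie in `S`, they are linearly independent (in particular pairwise distinct), and they
span `S`. -/
def OrderedMonomialsFormBasis {A : Type*} [Ring A] [Algebra ℂ A] {I : Type*} (x : I → A)
    (le : I → I → Prop) (S : Subalgebra ℂ A) : Prop :=
  ∃ b : Module.Basis (OrderedWord le) ℂ S, ∀ w, (b w : A) = (w.1.map x).prod

end Yangian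

/-! Two filtrations carry the argument: one gives independence of words in the $T_{i,j}^{(r)}$, the
other transfers it to the Gauss coefficients.

Independence uses the loop degree $r-1$ of $T_{i,j}^{(r)}$. For it the coproduct makes every letter
primitive up to lower terms (`comul_xFam`), and the evaluation $T(u)\mapsto 1+(u-t)^{-1}e$ supplies
functionals dual to single letters. Iterating the coproduct turns them into functionals that, among
words of no larger degree and length, see exactly the rearrangements of a given word
(`wordFun_tWord`). Hence words that are not rearrangements of each other are independent
(`linearIndependent_tWord`).

Now give $T_{i,j}^{(r)}$ degree $r$. The associated graded algebra is commutative
(`T_commutator_mem`), so ordered words span each filtration step. The factorization $T=FDE$ and its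
inverse respect degree, so the $D$, $E$, $F$ generate the same filtration (`wordFil_allFam`). Up to
degree $d$ there are finitely many ordered words, the same number for both families. The $D,E,F$
words span a space that contains as many independent $T$ words, so they are independent too
(`linearIndependent_allFam`).

It remains to see that the ordered monomials in the $D$, $E$ or $F$ alone span the three
subalgebras. This is a closure question: commutators of the $E_{i,j}^{(r)}$ must be lower-degree
expressions in the $E$ alone. Schur complements of RTT matrices are again RTT matrices
(`RTTPair.schur`), which reduces the relations to a single pivot. There the commutators are governed
by divided differences $(E(u)-E(v))/(u-v)$, which lower the degree by one (`gaussE_commutator_mem`).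
The same formulas produce $E_{i,j}$ from the $E_{i,i+1}$. Transposition over the opposite algebra
gives the results for $F$.

Ordered words for the order $F<D<E$ are triples of ordered words, so multiplication carries a tensor
product basis to a basis of $Y_n$. -/

set_option linter.unusedSimpArgs false

namespace Yangian

/-! ### Abstract RTT pairs -/

section RTTPair

variable {K A : Type*} [CommRing K] [Ring A] [Algebra K A] {ι : Type*}

/-- Two families `a = M(u)`, `b = M(v)` satisfy the RTT relation with `u - v = α / β`. -/
structure RTTPair (α β : K) (a b : ι → ι → A) : Prop where
  std : ∀ i j h k, α • (a i j * b h k - b h k * a i j) = β • (a h j * b i k - b h j * a i k)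
  alt : ∀ i j h k, α • (a i j * b h k - b h k * a i j) = β • (b i k * a h j - a i k * b h j)

/-- The block factorization of `m` with respect to the pivot `p`. -/
structure PivotData (m : ι → ι → A) (p : ι) (m₀ m₀' : A) (E F : ι → A) (m' : ι → ι → A) :
    Prop where
  inv_mul : m₀' * m₀ = 1
  mul_inv : m₀ * m₀' = 1
  pivot : m p p = m₀
  row : ∀ j, m p j = m₀ * E j
  col : ∀ i, m i p = F i * m₀
  schur : ∀ i j, m i j = m' i j + F i * m₀ * E j

theorem PivotData.cancel_left {m : ι → ι → A} {p : ι} {m₀ m₀' : A} {E F : ι → A}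
    {m' : ι → ι → A} (h : PivotData m p m₀ m₀' E F m') {x y : A} (hxy : m₀ * x = m₀ * y) :
    x = y := by
  have := congrArg (m₀' * ·) hxy
  simpa [← mul_assoc, h.inv_mul] using this

theorem PivotData.cancel_right {m : ι → ι → A} {p : ι} {m₀ m₀' : A} {E F : ι → A}
    {m' : ι → ι → A} (h : PivotData m p m₀ m₀' E F m') {x y : A} (hxy : x * m₀ = y * m₀) :
    x = y := by
  have := congrArg (· * m₀') hxy
  simpa [mul_assoc, h.mul_inv] using this

namespace RTTPair

variable {α β : K} {a b : ι → ι → A}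

/-- Exchanging $(i,j)$ with $(h,k)$ and $u$ with $v$ turns each form of the relation into the other,
so one form for both ordered pairs suffices. -/
theorem symm (H : RTTPair α β a b) : RTTPair (-α) β b a where
  std i j h k := by
    rw [← H.alt h k i j]; module
  alt i j h k := by
    rw [← H.std h k i j]; module

theorem mk_of_alt (h₁ : ∀ i j h k,
      α • (a i j * b h k - b h k * a i j) = β • (b i k * a h j - a i k * b h j))
    (h₂ : ∀ i j h k,
      (-α) • (b i j * a h k - a h k * b i j) = β • (a i k * b h j - b i k * a h j)) :
    RTTPair α β a b where
  alt := h₁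
  std i j h k := by
    rw [← h₂ h k i j]; module

/-- The matrix product of two RTT pairs with mutually commuting entries satisfies the RTT
relation. -/
theorem std_mul [Fintype ι] {c d : ι → ι → A}
    (H : RTTPair α β a b) (H' : RTTPair α β c d)
    (hcb : ∀ i j h k, c i j * b h k = b h k * c i j)
    (hda : ∀ i j h k, d i j * a h k = a h k * d i j) (i j h k : ι) :
    α • ((∑ p, a i p * c p j) * (∑ q, b h q * d q k) -
        (∑ q, b h q * d q k) * (∑ p, a i p * c p j)) =
      β • ((∑ p, a h p * c p j) * (∑ q, b i q * d q k) -
        (∑ p, b h p * d p j) * (∑ q, a i q * c q k)) := by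
  have e1 : ∀ p q, a i p * c p j * (b h q * d q k) = a i p * b h q * (c p j * d q k) := fun p q => by
    rw [mul_assoc, ← mul_assoc (c p j), hcb]; simp only [mul_assoc]
  have e2 : ∀ p q, b h q * d q k * (a i p * c p j) = b h q * a i p * (d q k * c p j) := fun p q => by
    rw [mul_assoc, ← mul_assoc (d q k), hda]; simp only [mul_assoc]
  have e3 : ∀ p q, a h p * c p j * (b i q * d q k) = a h p * b i q * (c p j * d q k) := fun p q => by
    rw [mul_assoc, ← mul_assoc (c p j), hcb]; simp only [mul_assoc]
  have e4 : ∀ p q, b h p * d p j * (a i q * c q k) = b h p * a i q * (d p j * c q k) := fun p q => by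
    rw [mul_assoc, ← mul_assoc (d p j), hda]; simp only [mul_assoc]
  rw [Finset.sum_mul_sum, Finset.sum_mul_sum, Finset.sum_mul_sum, Finset.sum_mul_sum]
  simp only [e1, e2, e3, e4]
  rw [Finset.sum_comm (f := fun q p => b h q * a i p * (d q k * c p j))]
  rw [← Finset.sum_sub_distrib, ← Finset.sum_sub_distrib]
  simp only [← Finset.sum_sub_distrib, Finset.smul_sum]
  -- This is $[ac,bd]=[a,b]cd+ba[c,d]$. After $p$ and $q$ are exchanged in the last summand, the
  -- mixed terms $b\,a\,c\,d$ cancel in the sum.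
  have e5 : ∀ p q, α • (a i p * b h q * (c p j * d q k) - b h q * a i p * (d q k * c p j)) =
     β • (a h p * b i q * (c p j * d q k) - b h p * a i q * (c p j * d q k)) + 
       β • (b h q * a i p * (c q j * d p k) - b h q * a i p * (d q j * c p k)) := fun p q => by
    linear_combination (norm := (simp only [mul_add, add_mul, mul_sub, sub_mul, smul_sub, smul_add,
      smul_mul_assoc, mul_smul_comm, mul_assoc]; module))
      H.std i p h q * (c p j * d q k) + b h q * a i p * H'.std p j q k
  simp only [e5, Finset.sum_add_distrib]
  rw [Finset.sum_comm (f := fun p q => β •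
    (b h q * a i p * (c q j * d p k) - b h q * a i p * (d q j * c p k)))]
  simp only [← Finset.sum_add_distrib]
  refine Finset.sum_congr rfl fun p _ => Finset.sum_congr rfl fun q _ => ?_
  module

variable {p : ι} {a₀ a₀' b₀ b₀' : A} {Ea Fa Eb Fb : ι → A} {a' b' : ι → ι → A}
  (H : RTTPair α β a b)
  (ha : PivotData a p a₀ a₀' Ea Fa a') (hb : PivotData b p b₀ b₀' Eb Fb b')
  (hα : ∀ x : A, α • x = 0 → x = 0) (h2 : ∀ x : A, x + x = 0 → x = 0)

include H ha hb hα h2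

/-- At the single index $p$ the two forms have right-hand sides $\beta[a_0,b_0]$ and
$-\beta[a_0,b_0]$. Their sum gives $2\alpha[a_0,b_0]=0$. -/
theorem pivot_comm : a₀ * b₀ = b₀ * a₀ := by
  have h1 := H.std p p p p
  have h3 := H.alt p p p p
  rw [ha.pivot, hb.pivot] at h1 h3
  refine sub_eq_zero.1 (h2 _ (hα _ ?_))
  rw [smul_add]
  nth_rw 1 [h1]
  rw [h3]
  module

theorem pivot_row (c : ι) : α • (a₀ * Eb c - Eb c * a₀) = β • (a₀ * (Eb c - Ea c)) := by
  have h0 := pivot_comm H ha hb hα h2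
  have h1 := H.std p p p c
  rw [ha.pivot, hb.pivot, hb.row, ha.row] at h1
  refine hb.cancel_left ?_
  have h3 : a₀ * (b₀ * Eb c) = b₀ * (a₀ * Eb c) := by rw [← mul_assoc, h0, mul_assoc]
  rw [h3] at h1
  linear_combination (norm := (simp only [mul_sub, smul_sub, mul_smul_comm, mul_assoc]; module)) h1

theorem pivot_col (h : ι) : α • (a₀ * Fb h - Fb h * a₀) = β • ((Fa h - Fb h) * a₀) := by
  have h0 := pivot_comm H ha hb hα h2
  have h1 := H.std p p h p
  rw [ha.pivot, hb.pivot, hb.col, ha.col, mul_assoc (Fb h), ← h0, mul_assoc (Fa h),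
    ← mul_assoc (Fb h)] at h1
  refine hb.cancel_right ?_
  linear_combination (norm := (simp only [sub_mul, smul_sub, smul_mul_assoc, mul_assoc]; module)) h1

/-- Substitute the block factorization into the relation at $(p,p),(h,k)$. The row and column
commutators account for everything except $\alpha[a_0,b'_{hk}]$. -/
theorem pivot_schur (h k : ι) : a₀ * b' h k = b' h k * a₀ := by
  have h0 := pivot_comm H ha hb hα h2
  have hr := pivot_row H ha hb hα h2 k
  have hc := pivot_col H ha hb hα h2 h
  have h1 := H.std p p h k
  rw [ha.pivot, hb.row, hb.col, ha.row, ha.col, hb.schur] at h1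
  have h3 : Fb h * (a₀ * b₀) * Eb k = Fb h * (b₀ * a₀) * Eb k := by rw [h0]
  refine sub_eq_zero.1 (hα _ ?_)
  linear_combination (norm := (simp only [mul_add, add_mul, mul_sub, sub_mul, smul_sub, smul_add,
    smul_mul_assoc, mul_smul_comm, mul_assoc]; module))
    h1 - hc * b₀ * Eb k - Fb h * b₀ * hr - α • h3 + β • h3

theorem schur_pivot (i j : ι) : a' i j * b₀ = b₀ * a' i j :=
  (pivot_schur H.symm hb ha (fun x hx => hα x (by simpa using hx)) h2 i j).symm

theorem schur_row (i j c : ι) :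
    α • (a' i j * Eb c - Eb c * a' i j) = β • (a' i c * (Ea j - Eb j)) := by
  have hs := schur_pivot H ha hb hα h2
  have h1 := H.alt i j p c
  have h3 := H.alt i p p c
  have h4 := H.alt p p p c
  have h5 := H.alt p j p c
  rw [ha.schur i j, ha.schur i c, hb.schur i c, hb.row, ha.row, hb.row] at h1
  rw [ha.col, ha.schur i c, hb.schur i c, hb.row, ha.pivot, hb.pivot] at h3
  rw [ha.pivot, hb.pivot, hb.row, ha.row] at h4
  rw [ha.row, hb.row, ha.row, hb.row] at h5
  refine hb.cancel_left ?_
  have e1 : α • (a' i j * b₀ * Eb c) = α • (b₀ * a' i j * Eb c) := by rw [hs]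
  have e2 : β • (a' i c * b₀ * (Ea j - Eb j)) = β • (b₀ * a' i c * (Ea j - Eb j)) := by rw [hs]
  -- Block elimination at the level of relations: $a_{ij}-a_{ip}E_j-F_ia_{pj}+F_ia_{pp}E_j=a'_{ij}$.
  -- The combinations for `schur_col` and `schur_alt` start the same way.
  linear_combination (norm := (simp only [mul_add, add_mul, mul_sub, sub_mul, smul_sub, smul_add,
    smul_mul_assoc, mul_smul_comm, mul_assoc]; module))
    h1 - h3 * Ea j + Fa i * h4 * Ea j - Fa i * h5 - e1 + e2

theorem schur_col (i j h : ι) :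
    α • (a' i j * Fb h - Fb h * a' i j) = β • ((Fb i - Fa i) * a' h j) := by
  have hs := schur_pivot H ha hb hα h2
  have h1 := H.alt i j h p
  have h3 := H.alt i p h p
  have h4 := H.alt p p h p
  have h5 := H.alt p j h p
  rw [ha.schur i j, ha.schur h j, hb.schur h j, hb.col, ha.col, hb.col] at h1
  rw [ha.col, ha.col, hb.col, hb.col] at h3
  rw [ha.pivot, hb.pivot, hb.col, ha.col] at h4
  rw [ha.row, hb.col, ha.schur h j, hb.schur h j, ha.pivot, hb.pivot] at h5
  refine hb.cancel_right ?_
  have e1 : α • (Fb h * (a' i j * b₀)) = α • (Fb h * (b₀ * a' i j)) := by rw [hs]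
  have e2 : β • ((Fb i - Fa i) * (a' h j * b₀)) = β • ((Fb i - Fa i) * (b₀ * a' h j)) := by rw [hs]
  linear_combination (norm := (simp only [mul_add, add_mul, mul_sub, sub_mul, smul_sub, smul_add,
    smul_mul_assoc, mul_smul_comm, mul_assoc]; module))
    h1 - h3 * Ea j + Fa i * h4 * Ea j - Fa i * h5 - e1 - e2

/-- Elimination gives the desired relation up to an error $\beta Z$. The row and column relations
show $\alpha Z=0$, and regularity of $\alpha$ removes it. -/
theorem schur_alt (i j h k : ι) :
    α • (a' i j * b' h k - b' h k * a' i j) = β • (b' i k * a' h j - a' i k * b' h j) := by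
  have hs := schur_pivot H ha hb hα h2
  have hr := schur_row H ha hb hα h2
  have hc := schur_col H ha hb hα h2
  have h1 := H.alt i j h k
  have h3 := H.alt i p h k
  have h4 := H.alt p p h k
  have h5 := H.alt p j h k
  rw [ha.schur i j, ha.schur h j, hb.schur h j, ha.schur i k, hb.schur h k, hb.schur i k] at h1
  rw [ha.col, ha.col, hb.col, ha.schur i k, hb.schur h k, hb.schur i k] at h3
  rw [ha.pivot, ha.col, ha.row, hb.col, hb.row, hb.schur h k] at h4
  rw [ha.row, ha.row, hb.row, ha.schur h j, hb.schur h j, hb.schur h k] at h5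
  have key : α • (a' i j * b' h k - b' h k * a' i j) - β • (b' i k * a' h j - a' i k * b' h j) =
      β • ((Fb i - Fa i) * (b₀ * (Eb k * a' h j - a' h j * Eb k)) -
        (a' i k * Fb h - Fb h * a' i k) * (b₀ * (Eb j - Ea j))) := by
    have e1 : Fb h * (a' i j * b₀) * Eb k = Fb h * (b₀ * a' i j) * Eb k := by rw [hs]
    have e2 : (Fb i - Fa i) * (a' h j * b₀) * Eb k = (Fb i - Fa i) * (b₀ * a' h j) * Eb k := by
      rw [hs]
    have e3 : Fb h * (a' i k * b₀) * (Eb j - Ea j) = Fb h * (b₀ * a' i k) * (Eb j - Ea j) := by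
      rw [hs]
    linear_combination (norm := (simp only [mul_add, add_mul, mul_sub, sub_mul, smul_sub, smul_add,
      smul_mul_assoc, mul_smul_comm, mul_assoc]; module))
      h1 - h3 * Ea j + Fa i * h4 * Ea j - Fa i * h5 - hc i j h * b₀ * Eb k
        - Fb h * b₀ * hr i j k - α • e1 - β • e2 - β • e3
  have e4 : (Fb i - Fa i) * (a' h k * b₀) * (Eb j - Ea j) =
      (Fb i - Fa i) * (b₀ * a' h k) * (Eb j - Ea j) := by rw [hs]
  have hz : (Fb i - Fa i) * (b₀ * (Eb k * a' h j - a' h j * Eb k)) -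
        (a' i k * Fb h - Fb h * a' i k) * (b₀ * (Eb j - Ea j)) = 0 := by
    refine hα _ ?_
    linear_combination (norm := (simp only [mul_add, add_mul, mul_sub, sub_mul, smul_sub, smul_add,
      smul_mul_assoc, mul_smul_comm, mul_assoc]; module))
      (Fa i - Fb i) * b₀ * hr h j k - hc i k h * b₀ * (Eb j - Ea j) - β • e4
  rw [hz, smul_zero] at key
  exact sub_eq_zero.1 key

/-- Schur complements of RTT pairs are RTT pairs. -/
theorem schur : RTTPair α β a' b' :=
  mk_of_alt (schur_alt H ha hb hα h2)
    (schur_alt H.symm hb ha (fun x hx => hα x (by simpa using hx)) h2)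

/-- Here $X=\beta(E_a-E_b)/\alpha$ plays the role of a divided difference. The identity is verified
after multiplication by $\alpha^2$ and both pivots, all of which can be cancelled. Every term on the
right contains $X$, which is the source of the drop in degree. -/
theorem row_row {X : ι → A} (hX : ∀ j, α • X j = β • (Ea j - Eb j)) (j c : ι) :
    Ea j * Eb c - Eb c * Ea j = Ea c * X j - X j * Eb c + X c * X j := by
  have h0 := pivot_comm H ha hb hα h2
  have hα' : ∀ x : A, (-α) • x = 0 → x = 0 := fun x hx => hα x (by simpa using hx)
  have hr := pivot_row H ha hb hα h2
  have hr' := pivot_row H.symm hb ha hα' h2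
  have h1 := H.alt p j p c
  rw [ha.row, hb.row, ha.row, hb.row] at h1
  refine sub_eq_zero.1 (hα _ (hα _ ?_))
  refine hb.cancel_left (ha.cancel_left ?_)
  have e : ∀ z, α • α • (a₀ * (b₀ * z)) = α • α • (b₀ * (a₀ * z)) := fun z => by
    rw [← mul_assoc, h0, mul_assoc]
  have e' : ∀ z, β • α • (a₀ * (b₀ * z)) = β • α • (b₀ * (a₀ * z)) := fun z => by
    rw [← mul_assoc, h0, mul_assoc]
  have e'' : ∀ z, β • β • (a₀ * (b₀ * z)) = β • β • (b₀ * (a₀ * z)) := fun z => by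
    rw [← mul_assoc, h0, mul_assoc]
  linear_combination (norm := (simp only [mul_add, add_mul, mul_sub, sub_mul, smul_sub, smul_add,
    smul_mul_assoc, mul_smul_comm, mul_assoc, mul_zero]; module))
    α • h1 - α • (a₀ * hr' j * Eb c) - α • (b₀ * hr c * Ea j) - β • (b₀ * hr c * Ea j)
      - β • (a₀ * hr' c * Eb j) - α • (a₀ * b₀ * Ea c * hX j) + α • (a₀ * b₀ * hX j * Eb c)
      - α • (a₀ * b₀ * hX c * X j) - β • (a₀ * b₀ * (Ea c - Eb c) * hX j)
      - e (Eb c * Ea j) - e' (Ea c * Ea j) + e'' ((Eb c - Ea c) * Ea j)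

end RTTPair

/-- Commutators with $e$ of the rank-one shape $m_{ic}X_j$ keep this shape under elimination, with
$X_j$ replaced by $X_j-X_pE_j$. This permits induction along successive Schur complements. -/
theorem PivotData.row_commutator {m : ι → ι → A} {p : ι} {m₀ m₀' : A} {E F : ι → A}
    {m' : ι → ι → A} (H : PivotData m p m₀ m₀' E F m') {e : A} {X : ι → A} {c : ι}
    (hX : ∀ i j, m i j * e - e * m i j = m i c * X j) (j : ι) :
    E j * e - e * E j = E c * (X j - X p * E j) := by
  have h1 := hX p j
  have h2 := hX p p
  rw [H.pivot] at h2
  rw [H.row, H.row] at h1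
  rw [H.row] at h2
  refine H.cancel_left ?_
  linear_combination (norm := noncomm_ring) h1 - h2 * E j

theorem PivotData.schur_commutator {m : ι → ι → A} {p : ι} {m₀ m₀' : A} {E F : ι → A}
    {m' : ι → ι → A} (H : PivotData m p m₀ m₀' E F m') {e : A} {X : ι → A} {c : ι}
    (hX : ∀ i j, m i j * e - e * m i j = m i c * X j) (i j : ι) :
    m' i j * e - e * m' i j = m' i c * (X j - X p * E j) := by
  have h1 := hX i j
  have h2 := hX i p
  have h3 := H.row_commutator hX j
  rw [H.schur, H.schur] at h1
  rw [H.col, H.schur] at h2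
  linear_combination (norm := noncomm_ring) h1 - h2 * E j - F i * m₀ * h3

end RTTPair

end Yangian

namespace Yangian

/-! ### Power series in two variables -/

section TwoVar

variable {R : Type*} [Ring R]

/-- Power series in the two central variables `x = u⁻¹` (inner) and `y = v⁻¹` (outer). -/
abbrev TwoVar (R : Type*) [Ring R] : Type _ := PowerSeries (PowerSeries R)

/-- The coefficient of `x ^ r * y ^ s`. -/
noncomputable def cf (r s : ℕ) : TwoVar R →+ R :=
  (PowerSeries.coeff r).toAddMonoidHom.comp (PowerSeries.coeff s).toAddMonoidHom

theorem cf_apply (r s : ℕ) (f : TwoVar R) :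
    cf r s f = PowerSeries.coeff r (PowerSeries.coeff s f) := rfl

theorem ext_cf {f g : TwoVar R} (h : ∀ r s, cf r s f = cf r s g) : f = g := by
  ext s r
  exact h r s

/-- `f(x)` as a series in two variables. -/
noncomputable def serX : PowerSeries R →+* TwoVar R := PowerSeries.C

/-- `f(y)` as a series in two variables. -/
noncomputable def serY : PowerSeries R →+* TwoVar R := PowerSeries.map PowerSeries.C

theorem cf_serX (r s : ℕ) (f : PowerSeries R) :
    cf r s (serX f) = if s = 0 then PowerSeries.coeff r f else 0 := by
  rw [cf_apply, serX, PowerSeries.coeff_C]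
  split_ifs <;> simp

theorem cf_serY (r s : ℕ) (f : PowerSeries R) :
    cf r s (serY f) = if r = 0 then PowerSeries.coeff s f else 0 := by
  rw [cf_apply, serY, PowerSeries.coeff_map, PowerSeries.coeff_C]

theorem cf_serX_mul (r s : ℕ) (f : PowerSeries R) (g : PowerSeries R) :
    cf r s (serX f * serY g) = PowerSeries.coeff r f * PowerSeries.coeff s g := by
  rw [cf_apply, serX, PowerSeries.coeff_C_mul, serY, PowerSeries.coeff_map,
    PowerSeries.coeff_mul_C]

theorem cf_serY_mul (r s : ℕ) (f : PowerSeries R) (g : PowerSeries R) :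
    cf r s (serY g * serX f) = PowerSeries.coeff s g * PowerSeries.coeff r f := by
  rw [cf_apply, serX, PowerSeries.coeff_mul_C, serY, PowerSeries.coeff_map,
    PowerSeries.coeff_C_mul]

theorem cf_mul (r s : ℕ) (f g : TwoVar R) :
    cf r s (f * g) = ∑ p ∈ Finset.HasAntidiagonal.antidiagonal s,
      ∑ q ∈ Finset.HasAntidiagonal.antidiagonal r,
      cf q.1 p.1 f * cf q.2 p.2 g := by
  simp only [cf_apply, PowerSeries.coeff_mul, map_sum]

theorem X_mem_center : (PowerSeries.X : PowerSeries R) ∈ Subring.center (PowerSeries R) :=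
  Subring.mem_center_iff.2 fun f => (PowerSeries.commute_X f).eq

/-- The central element `y - x = (u - v) / (u v)`. -/
noncomputable def alphaC : Subring.center (TwoVar R) :=
  ⟨PowerSeries.X - PowerSeries.C PowerSeries.X, Subring.sub_mem _ X_mem_center
    (Subring.mem_center_iff.2 fun f => by
      ext s : 1
      rw [PowerSeries.coeff_mul_C, PowerSeries.coeff_C_mul]
      exact (PowerSeries.commute_X _).eq)⟩

/-- The central element `x y`. -/
noncomputable def betaC : Subring.center (TwoVar R) :=
  ⟨PowerSeries.X * PowerSeries.C PowerSeries.X, Subring.mul_mem _ X_mem_center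
    (Subring.mem_center_iff.2 fun f => by
      ext s : 1
      rw [PowerSeries.coeff_mul_C, PowerSeries.coeff_C_mul]
      exact (PowerSeries.commute_X _).eq)⟩

theorem alphaC_smul (f : TwoVar R) :
    (alphaC : Subring.center (TwoVar R)) • f =
      PowerSeries.X * f - PowerSeries.C PowerSeries.X * f := by
  rw [Subring.smul_def, smul_eq_mul]
  exact sub_mul _ _ _

theorem betaC_smul (f : TwoVar R) :
    (betaC : Subring.center (TwoVar R)) • f =
      PowerSeries.X * (PowerSeries.C PowerSeries.X * f) := by
  rw [Subring.smul_def, smul_eq_mul]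
  exact mul_assoc _ _ _

theorem cf_alphaC (f : TwoVar R) :
    cf 0 0 ((alphaC : Subring.center (TwoVar R)) • f) = 0 ∧
    (∀ s, cf 0 (s + 1) ((alphaC : Subring.center (TwoVar R)) • f) = cf 0 s f) ∧
    (∀ r, cf (r + 1) 0 ((alphaC : Subring.center (TwoVar R)) • f) = -cf r 0 f) ∧
    (∀ r s, cf (r + 1) (s + 1) ((alphaC : Subring.center (TwoVar R)) • f) =
      cf (r + 1) s f - cf r (s + 1) f) := by
  simp [alphaC_smul, cf_apply, PowerSeries.coeff_succ_X_mul, PowerSeries.coeff_zero_X_mul,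
    PowerSeries.coeff_C_mul, -PowerSeries.coeff_zero_eq_constantCoeff]

theorem cf_betaC (f : TwoVar R) :
    (∀ s, cf 0 s ((betaC : Subring.center (TwoVar R)) • f) = 0) ∧
    (∀ r, cf r 0 ((betaC : Subring.center (TwoVar R)) • f) = 0) ∧
    (∀ r s, cf (r + 1) (s + 1) ((betaC : Subring.center (TwoVar R)) • f) = cf r s f) := by
  refine ⟨fun s => ?_, fun r => ?_, fun r s => ?_⟩
  · cases s <;>
    simp [betaC_smul, cf_apply, PowerSeries.coeff_succ_X_mul, PowerSeries.coeff_zero_X_mul,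
      PowerSeries.coeff_C_mul, -PowerSeries.coeff_zero_eq_constantCoeff]
  all_goals
    simp [betaC_smul, cf_apply, PowerSeries.coeff_succ_X_mul, PowerSeries.coeff_zero_X_mul,
      PowerSeries.coeff_C_mul, -PowerSeries.coeff_zero_eq_constantCoeff]

/-- In $(y-x)f=0$ the coefficient of $y^0$ forces the $y^0$ part of $f$ to vanish; each further
power of $y$ then repeats the argument. -/
theorem alphaC_regular (f : TwoVar R) (hf : (alphaC : Subring.center (TwoVar R)) • f = 0) :
    f = 0 := by
  obtain ⟨-, -, h1, h2⟩ := cf_alphaC f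
  simp only [hf, map_zero] at h1 h2
  have : ∀ s r, cf r s f = 0 := by
    intro s
    induction s with
    | zero => intro r; exact neg_eq_zero.1 (h1 r).symm
    | succ s ih => intro r; simpa [ih] using (h2 r s).symm
  exact ext_cf fun r s => by simp [this]

theorem alphaC_cancel {f g : TwoVar R}
    (h : (alphaC : Subring.center (TwoVar R)) • f = (alphaC : Subring.center (TwoVar R)) • g) :
    f = g :=
  sub_eq_zero.1 (alphaC_regular _ (by rw [smul_sub, h, sub_self]))

theorem two_regular [Algebra ℂ R] (f : TwoVar R) (hf : f + f = 0) : f = 0 := by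
  refine ext_cf fun r s => ?_
  have h : cf r s f + cf r s f = 0 := by rw [← map_add, hf, map_zero]
  rw [← two_smul ℂ] at h
  simpa using h

/-- The divided difference `(f(x) - f(y)) / (u - v)`. -/
noncomputable def divDiff (f : PowerSeries R) : TwoVar R :=
  PowerSeries.mk fun s => PowerSeries.mk fun r =>
    if 1 ≤ r ∧ 1 ≤ s then -PowerSeries.coeff (r + s - 1) f else 0

theorem cf_divDiff (r s : ℕ) (f : PowerSeries R) :
    cf r s (divDiff f) = if 1 ≤ r ∧ 1 ≤ s then -PowerSeries.coeff (r + s - 1) f else 0 := by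
  rw [cf_apply, divDiff, PowerSeries.coeff_mk, PowerSeries.coeff_mk]

/-- For monomials this is $xy\,(x^m-y^m)/(y-x)=-\sum x^ry^s$ over $r,s\ge1$ with $r+s=m+1$. -/
theorem alphaC_smul_divDiff (f : PowerSeries R) :
    (alphaC : Subring.center (TwoVar R)) • divDiff f =
      (betaC : Subring.center (TwoVar R)) • (serX f - serY f) := by
  refine ext_cf fun r s => ?_
  obtain ⟨a1, a2, a3, a4⟩ := cf_alphaC (divDiff f)
  obtain ⟨b1, b2, b3⟩ := cf_betaC (serX f - serY f)
  rcases r with _ | r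
  · rcases s with _ | s
    · rw [a1, b1]
    · rw [a2, b1]; simp [cf_divDiff]
  · rcases s with _ | s
    · rw [a3, b2]; simp [cf_divDiff]
    · rw [a4, b3, cf_divDiff, cf_divDiff, map_sub, cf_serX, cf_serY]
      rcases r with _ | r
      · rcases s with _ | s <;> simp
      · rcases s with _ | s
        · simp
        · have : r + 1 + 1 + (s + 1) - 1 = r + 1 + (s + 1 + 1) - 1 := by omega
          simp [this]

end TwoVar

/-! ### Matrices satisfying the RTT relation -/

section IsRTT

variable {R : Type*} [Ring R] {ι : Type*}

/-- The RTT relation for a matrix of power series, in terms of coefficients. -/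
def IsRTT (M : ι → ι → PowerSeries R) : Prop :=
  ∀ i j h k r s, ⁅PowerSeries.coeff (r + 1) (M i j), PowerSeries.coeff s (M h k)⁆ -
      ⁅PowerSeries.coeff r (M i j), PowerSeries.coeff (s + 1) (M h k)⁆ =
    PowerSeries.coeff r (M h j) * PowerSeries.coeff s (M i k) -
      PowerSeries.coeff s (M h j) * PowerSeries.coeff r (M i k)

theorem IsRTT.of_std {M : ι → ι → PowerSeries R}
    (H : ∀ i j h k, (alphaC : Subring.center (TwoVar R)) •
        (serX (M i j) * serY (M h k) - serY (M h k) * serX (M i j)) =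
      (betaC : Subring.center (TwoVar R)) •
        (serX (M h j) * serY (M i k) - serY (M h j) * serX (M i k))) : IsRTT M := by
  intro i j h k r s
  have := congrArg (cf (r + 1) (s + 1)) (H i j h k)
  rw [(cf_alphaC _).2.2.2, (cf_betaC _).2.2] at this
  simpa only [map_sub, cf_serX_mul, cf_serY_mul, Ring.lie_def] using this

/-- The coefficientwise relation covers only $x^{r+1}y^{s+1}$. The boundary coefficients, where
$\beta$ contributes nothing, need the constant terms to be central. -/
theorem IsRTT.pair {M : ι → ι → PowerSeries R} (H : IsRTT M)
    (hM : ∀ i j x, PowerSeries.coeff 0 (M i j) * x = x * PowerSeries.coeff 0 (M i j)) :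
    RTTPair (alphaC : Subring.center (TwoVar R)) betaC
      (fun i j => serX (M i j)) (fun i j => serY (M i j)) := by
  constructor
  · intro i j h k
    refine ext_cf fun r s => ?_
    obtain ⟨a1, a2, a3, a4⟩ := cf_alphaC
      (serX (M i j) * serY (M h k) - serY (M h k) * serX (M i j))
    obtain ⟨b1, b2, b3⟩ := cf_betaC (serX (M h j) * serY (M i k) - serY (M h j) * serX (M i k))
    rcases r with _ | r
    · rcases s with _ | s
      · rw [a1, b1]
      · rw [a2, b1, map_sub, cf_serX_mul, cf_serY_mul, hM, sub_self]
    · rcases s with _ | s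
      · rw [a3, b2, map_sub, cf_serX_mul, cf_serY_mul, hM, sub_self, neg_zero]
      · rw [a4, b3]
        simpa only [map_sub, cf_serX_mul, cf_serY_mul, Ring.lie_def] using H i j h k r s
  · intro i j h k
    refine ext_cf fun r s => ?_
    obtain ⟨a1, a2, a3, a4⟩ := cf_alphaC
      (serX (M i j) * serY (M h k) - serY (M h k) * serX (M i j))
    obtain ⟨b1, b2, b3⟩ := cf_betaC (serY (M i k) * serX (M h j) - serX (M i k) * serY (M h j))
    rcases r with _ | r
    · rcases s with _ | s
      · rw [a1, b1]
      · rw [a2, b1, map_sub, cf_serX_mul, cf_serY_mul, hM, sub_self]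
    · rcases s with _ | s
      · rw [a3, b2, map_sub, cf_serX_mul, cf_serY_mul, hM, sub_self, neg_zero]
      · rw [a4, b3]
        have := H h k i j s r
        simp only [map_sub, cf_serX_mul, cf_serY_mul, Ring.lie_def] at this ⊢
        rw [← this]
        abel

end IsRTT

/-! ### Schur complements of RTT matrices -/

section SchurRTT

variable {R : Type*} [Ring R] {n : ℕ} {M : Matrix (Fin n) (Fin n) (PowerSeries R)}
  (hM : ∀ i j, PowerSeries.constantCoeff (M i j) = if i = j then 1 else 0)

include hM in
theorem schur_pivotData {A : Type*} [Ring A] (f : PowerSeries R →+* A) (l : Fin n) :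
    PivotData (fun i j => f (schur M l i j)) l (f (gaussD M l)) (f (invSer (gaussD M l)))
      (fun j => f (gaussE M l j)) (fun i => f (gaussF M l i))
      (fun i j => f (schur M (l + 1) i j)) where
  inv_mul := by rw [← map_mul, invSer_mul_gaussD M hM, map_one]
  mul_inv := by rw [← map_mul, gaussD_mul_invSer M hM, map_one]
  pivot := rfl
  row j := by
    rw [← map_mul, gaussE, ← mul_assoc, gaussD_mul_invSer M hM, one_mul]
  col i := by
    rw [← map_mul, gaussF, mul_assoc, invSer_mul_gaussD M hM, mul_one]
  schur i j := by
    rw [← map_mul, ← map_mul, ← map_add, schur_succ, gaussF, gaussE,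
      mul_assoc (schur M l i l) (invSer (gaussD M l)) (gaussD M l), invSer_mul_gaussD M hM,
      mul_one, ← mul_assoc, sub_add_cancel]

theorem gaussE_self (hM : ∀ i j, PowerSeries.constantCoeff (M i j) = if i = j then 1 else 0)
    (i : Fin n) : gaussE M i i = 1 := invSer_mul_gaussD M hM i

include hM in
theorem gaussE_of_lt {i j : Fin n} (h : j < i) : gaussE M i j = 0 := by
  rw [gaussE, schur_eq_zero M hM i i.2.le i j (Or.inr h), mul_zero]

include hM in
theorem schur_coeff_zero_comm (k : ℕ) (i j : Fin n) (x : R) :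
    PowerSeries.coeff 0 (schur M k i j) * x = x * PowerSeries.coeff 0 (schur M k i j) := by
  rw [PowerSeries.coeff_zero_eq_constantCoeff_apply, constantCoeff_schur M hM]
  split_ifs <;> simp

variable [Algebra ℂ R] (H : IsRTT M)

include hM H

theorem isRTT_schur (k : ℕ) : IsRTT (schur M k) := by
  induction k with
  | zero => exact H
  | succ k ih =>
    by_cases hk : k < n
    · exact IsRTT.of_std ((ih.pair (schur_coeff_zero_comm hM k)).schur
        (schur_pivotData hM serX ⟨k, hk⟩) (schur_pivotData hM serY ⟨k, hk⟩)
        alphaC_regular two_regular).std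
    · have : schur M (k + 1) = schur M k := by
        ext1 i j; simp [schur, hk]
      rw [this]; exact ih

theorem schur_pair (k : ℕ) : RTTPair (alphaC : Subring.center (TwoVar R)) betaC
      (fun i j => serX (schur M k i j)) (fun i j => serY (schur M k i j)) :=
  (isRTT_schur hM H k).pair (schur_coeff_zero_comm hM k)

/-- The first complement after the pivot $p$ commutes with $D_p$ by `pivot_schur`. Later complements
are built from its entries and inverses of their pivots, so they commute as well. -/
theorem commute_gaussD_schur (p : Fin n) (k : ℕ) (hk : p.1 < k) (hkn : k ≤ n) (i j : Fin n) :
    Commute (serX (gaussD M p)) (serY (schur M k i j)) := by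
  induction k, hk using Nat.le_induction generalizing i j with
  | base =>
    exact (schur_pair hM H p).pivot_schur (schur_pivotData hM serX p) (schur_pivotData hM serY p)
      alphaC_regular two_regular i j
  | succ k hk ih =>
    have ih := ih (by omega)
    have hs := schur_succ M ⟨k, hkn⟩ i j
    simp only at hs
    rw [hs, map_sub, map_mul, map_mul]
    refine (ih _ _).sub_right (((ih _ _).mul_right ?_).mul_right (ih _ _))
    have h1 := (schur_pivotData hM (serY (R := R)) ⟨k, hkn⟩).mul_inv
    have h2 := (schur_pivotData hM (serY (R := R)) ⟨k, hkn⟩).inv_mul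
    let u : (TwoVar R)ˣ := ⟨_, _, h1, h2⟩
    exact Commute.units_inv_right (u := u) (ih _ _)

theorem commute_gaussD (p q : Fin n) (r s : ℕ) :
    Commute (PowerSeries.coeff r (gaussD M p)) (PowerSeries.coeff s (gaussD M q)) := by
  have key : ∀ p q : Fin n, p ≤ q → ∀ r s,
      Commute (PowerSeries.coeff r (gaussD M p)) (PowerSeries.coeff s (gaussD M q)) := by
    intro p q hpq r s
    have : Commute (serX (gaussD M p)) (serY (gaussD M q)) := by
      rcases hpq.eq_or_lt with rfl | hpq
      · exact (schur_pair hM H p).pivot_comm (schur_pivotData hM serX p)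
          (schur_pivotData hM serY p) alphaC_regular two_regular
      · exact commute_gaussD_schur hM H p q hpq q.2.le q q
    have := congrArg (cf r s) this.eq
    rwa [cf_serX_mul, cf_serY_mul] at this
  rcases le_total p q with h | h
  · exact key p q h r s
  · exact (key q p h s r).symm

end SchurRTT

end Yangian

namespace Yangian

/-! ### Filtrations and two-variable series -/

section Filtration

variable {R : Type*} [Ring R] [Algebra ℂ R]

/-- A multiplicative increasing filtration. -/
structure IsMulFiltration (V : ℕ → Submodule ℂ R) : Prop where
  one_mem : 1 ∈ V 0
  mul_mem : ∀ {a b x y}, x ∈ V a → y ∈ V b → x * y ∈ V (a + b)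
  mono : Monotone V

/-- The filtration shifted by one step. -/
def predFil (V : ℕ → Submodule ℂ R) : ℕ → Submodule ℂ R
  | 0 => ⊥
  | d + 1 => V d

/-- The coefficient of `x ^ r * y ^ s` lies in the `(r + s)`-th step of the filtration. -/
def InDeg (V : ℕ → Submodule ℂ R) (f : TwoVar R) : Prop := ∀ r s, cf r s f ∈ V (r + s)

theorem InDeg.mul {V V' V'' : ℕ → Submodule ℂ R}
    (h : ∀ {a b x y}, x ∈ V a → y ∈ V' b → x * y ∈ V'' (a + b)) {f g : TwoVar R}
    (hf : InDeg V f) (hg : InDeg V' g) : InDeg V'' (f * g) := by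
  intro r s
  rw [cf_mul]
  refine Submodule.sum_mem _ fun p hp => Submodule.sum_mem _ fun q hq => ?_
  rw [Finset.HasAntidiagonal.mem_antidiagonal] at hp hq
  have := h (hf q.1 p.1) (hg q.2 p.2)
  rwa [show q.1 + p.1 + (q.2 + p.2) = r + s by omega] at this

theorem InDeg.add {V : ℕ → Submodule ℂ R} {f g : TwoVar R} (hf : InDeg V f) (hg : InDeg V g) :
    InDeg V (f + g) := fun r s => by
  rw [map_add]; exact add_mem (hf r s) (hg r s)

theorem InDeg.sub {V : ℕ → Submodule ℂ R} {f g : TwoVar R} (hf : InDeg V f) (hg : InDeg V g) :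
    InDeg V (f - g) := fun r s => by
  rw [map_sub]; exact sub_mem (hf r s) (hg r s)

theorem InDeg.serX {V : ℕ → Submodule ℂ R} {f : PowerSeries R}
    (hf : ∀ r, PowerSeries.coeff r f ∈ V r) : InDeg V (serX f) := fun r s => by
  rw [cf_serX]
  split_ifs with h
  · subst h; exact hf r
  · exact zero_mem _

theorem InDeg.serY {V : ℕ → Submodule ℂ R} {f : PowerSeries R}
    (hf : ∀ r, PowerSeries.coeff r f ∈ V r) : InDeg V (serY f) := fun r s => by
  rw [cf_serY]
  split_ifs with h
  · subst h; simpa using hf s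
  · exact zero_mem _

/-- The coefficient at $x^ry^s$ is $-f_{r+s-1}$: a divided difference sits one step lower than its
total degree allows. -/
theorem InDeg.divDiff {V : ℕ → Submodule ℂ R} {f : PowerSeries R}
    (hf : ∀ r, PowerSeries.coeff r f ∈ V r) : InDeg (predFil V) (divDiff f) := fun r s => by
  rw [cf_divDiff]
  split_ifs with h
  · obtain ⟨d, hd⟩ : ∃ d, r + s = d + 1 := ⟨r + s - 1, by omega⟩
    rw [hd]
    exact neg_mem (hf d)
  · exact zero_mem _

variable {V : ℕ → Submodule ℂ R} (hV : IsMulFiltration V)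

include hV

theorem IsMulFiltration.mul_predFil {a b : ℕ} {x y : R} (hx : x ∈ V a) (hy : y ∈ predFil V b) :
    x * y ∈ predFil V (a + b) := by
  rcases b with _ | b
  · rw [(Submodule.mem_bot ℂ).1 hy, mul_zero]; exact zero_mem _
  · exact hV.mul_mem hx hy

theorem IsMulFiltration.predFil_mul {a b : ℕ} {x y : R} (hx : x ∈ predFil V a) (hy : y ∈ V b) :
    x * y ∈ predFil V (a + b) := by
  rcases a with _ | a
  · rw [(Submodule.mem_bot ℂ).1 hx, zero_mul]; exact zero_mem _
  · rw [show a + 1 + b = (a + b) + 1 by omega]; exact hV.mul_mem hx hy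

theorem IsMulFiltration.predFil_le (d : ℕ) : predFil V d ≤ V d := by
  rcases d with _ | d
  · exact bot_le
  · exact hV.mono (Nat.le_succ d)

end Filtration

/-! ### Commutators of the upper Gauss coefficients -/

section GaussE

variable {R : Type*} [Ring R] [Algebra ℂ R] {n : ℕ}
  {M : Matrix (Fin n) (Fin n) (PowerSeries R)}
  (hM : ∀ i j, PowerSeries.constantCoeff (M i j) = if i = j then 1 else 0) (H : IsRTT M)

include hM in
theorem coeff_gaussE_mem {V : ℕ → Submodule ℂ R} (h1 : 1 ∈ V 0)
    (hE : ∀ i j, i < j → ∀ r, PowerSeries.coeff r (gaussE M i j) ∈ V r) (i j : Fin n) (r : ℕ) :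
    PowerSeries.coeff r (gaussE M i j) ∈ V r := by
  rcases lt_trichotomy i j with h | rfl | h
  · exact hE i j h r
  · rw [gaussE_self hM, PowerSeries.coeff_one]
    split_ifs with h
    · subst h; exact h1
    · exact zero_mem _
  · rw [gaussE_of_lt hM h]; exact zero_mem _

include hM H

/-- `schur_row` with the factor $\alpha$ divided out; the result has the rank-one shape that
survives elimination. -/
theorem schur_commutator_gaussE (p c : Fin n) (i j : Fin n) :
    serX (schur M (p + 1) i j) * serY (gaussE M p c) -
        serY (gaussE M p c) * serX (schur M (p + 1) i j) =
      serX (schur M (p + 1) i c) * divDiff (gaussE M p j) := by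
  refine alphaC_cancel ?_
  rw [(schur_pair hM H p).schur_row (schur_pivotData hM serX p) (schur_pivotData hM serY p)
      alphaC_regular two_regular i j c, ← mul_smul_comm, ← alphaC_smul_divDiff, mul_smul_comm]

theorem exists_schur_commutator_gaussE {V : ℕ → Submodule ℂ R} (hV : IsMulFiltration V)
    (hE : ∀ i j, i < j → ∀ r, PowerSeries.coeff r (gaussE M i j) ∈ V r)
    (p c : Fin n) (k : ℕ) (hk : p.1 < k) (hkn : k ≤ n) :
    ∃ X : Fin n → TwoVar R, (∀ j, InDeg (predFil V) (X j)) ∧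
      ∀ i j, serX (schur M k i j) * serY (gaussE M p c) -
        serY (gaussE M p c) * serX (schur M k i j) = serX (schur M k i c) * X j := by
  have hE := coeff_gaussE_mem hM hV.one_mem hE
  induction k, hk using Nat.le_induction with
  | base =>
    exact ⟨fun j => divDiff (gaussE M p j), fun j => InDeg.divDiff (hE p j),
      schur_commutator_gaussE hM H p c⟩
  | succ k hk ih =>
    obtain ⟨X, hX, h⟩ := ih (by omega)
    refine ⟨fun j => X j - X ⟨k, hkn⟩ * serX (gaussE M ⟨k, hkn⟩ j), fun j => ?_, ?_⟩
    · exact (hX j).sub (InDeg.mul hV.predFil_mul (hX _) (InDeg.serX (hE _ j)))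
    · exact (schur_pivotData hM serX ⟨k, hkn⟩).schur_commutator h

/-- Within one row the formula `row_row` applies. For different rows, the rank-one commutator is
carried from the pivot $p$ down to the complement whose first row defines $E_{q,j}$. -/
theorem gaussE_commutator_inDeg {V : ℕ → Submodule ℂ R} (hV : IsMulFiltration V)
    (hE : ∀ i j, i < j → ∀ r, PowerSeries.coeff r (gaussE M i j) ∈ V r)
    (p q : Fin n) (hpq : p ≤ q) (c j : Fin n) :
    InDeg (predFil V) (serX (gaussE M q j) * serY (gaussE M p c) -
        serY (gaussE M p c) * serX (gaussE M q j)) := by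
  have hE' := coeff_gaussE_mem hM hV.one_mem hE
  rcases hpq.eq_or_lt with rfl | hpq
  · rw [(schur_pair hM H p).row_row (schur_pivotData hM serX p) (schur_pivotData hM serY p)
      alphaC_regular two_regular (X := fun j => divDiff (gaussE M p j))
      (fun j => alphaC_smul_divDiff _)]
    have hX := fun j => InDeg.divDiff (hE' p j)
    refine ((InDeg.mul hV.mul_predFil (InDeg.serX (hE' p c)) (hX j)).sub
      (InDeg.mul hV.predFil_mul (hX j) (InDeg.serY (hE' p c)))).add
      (InDeg.mul (fun hx hy => hV.mul_predFil (hV.predFil_le _ hx) hy) (hX c) (hX j))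
  · obtain ⟨X, hX, h⟩ := exists_schur_commutator_gaussE hM H hV hE p c q hpq q.2.le
    rw [(schur_pivotData hM serX q).row_commutator h j]
    exact InDeg.mul hV.mul_predFil (InDeg.serX (hE' q c))
      ((hX j).sub (InDeg.mul hV.predFil_mul (hX q) (InDeg.serX (hE' q j))))

/-- The upper Gauss coefficients commute up to lower terms, in any multiplicative filtration. -/
theorem gaussE_commutator_mem {V : ℕ → Submodule ℂ R} (hV : IsMulFiltration V)
    (hE : ∀ i j, i < j → ∀ r, PowerSeries.coeff r (gaussE M i j) ∈ V r)
    (i j h k : Fin n) (r s : ℕ) :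
    PowerSeries.coeff r (gaussE M i j) * PowerSeries.coeff s (gaussE M h k) -
      PowerSeries.coeff s (gaussE M h k) * PowerSeries.coeff r (gaussE M i j) ∈
        predFil V (r + s) := by
  rcases le_total h i with hi | hi
  · have := gaussE_commutator_inDeg hM H hV hE h i hi k j r s
    rwa [map_sub, cf_serX_mul, cf_serY_mul] at this
  · have := gaussE_commutator_inDeg hM H hV hE i h hi j k s r
    rw [map_sub, cf_serX_mul, cf_serY_mul, add_comm s r] at this
    rw [← neg_sub]
    exact neg_mem this

/-- A subalgebra containing the coefficients of all `E_{i,i+1}(u)` contains those of all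
`E_{i,j}(u)`. -/
theorem coeff_gaussE_mem_subalgebra (P : Subalgebra ℂ R)
    (hP : ∀ i j : Fin n, j.1 = i.1 + 1 → ∀ r, PowerSeries.coeff r (gaussE M i j) ∈ P)
    (i j : Fin n) (hij : i < j) (r : ℕ) : PowerSeries.coeff r (gaussE M i j) ∈ P := by
  obtain ⟨d, hd⟩ : ∃ d, j.1 = i.1 + d + 1 := ⟨j - i - 1, by omega⟩
  induction d generalizing i r with
  | zero => exact hP i j hd r
  | succ d ih =>
    let q : Fin n := ⟨i + 1, by omega⟩
    have hq := fun r => ih q (show i.1 + 1 < j by omega) r (show j.1 = i.1 + 1 + d + 1 by omega)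
    have hiq := hP i q rfl
    -- For $q=i+1$ this reads $[E_{q,j}(u),E_{i,q}(v)]=X_j-X_qE_{q,j}(u)$, where $X_j$ and $X_q$ are
    -- the divided differences of $E_{i,j}$ and $E_{i,q}$. Everything except $X_j$ has coefficients
    -- in `P` by induction.
    have h := (schur_pivotData hM serX q).row_commutator (schur_commutator_gaussE hM H i q) j
    rw [gaussE_self hM, map_one, one_mul] at h
    -- For the constant filtration at `P`, the degree lemmas only express that `P` is closed under
    -- products.
    let V : ℕ → Submodule ℂ R := fun _ => Subalgebra.toSubmodule P
    have hV : IsMulFiltration V :=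
      ⟨one_mem P, fun hx hy => P.mul_mem hx hy, fun _ _ _ => le_rfl⟩
    have h1 : InDeg V (divDiff (gaussE M i q) * serX (gaussE M q j)) :=
      InDeg.mul hV.mul_mem (fun r s => hV.predFil_le _ (InDeg.divDiff (V := V) hiq r s))
        (InDeg.serX hq)
    have h2 : InDeg V (serX (gaussE M q j) * serY (gaussE M i q) -
        serY (gaussE M i q) * serX (gaussE M q j)) :=
      (InDeg.mul hV.mul_mem (InDeg.serX hq) (InDeg.serY hiq)).sub
        (InDeg.mul hV.mul_mem (InDeg.serY hiq) (InDeg.serX hq))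
    rw [h] at h2
    -- The coefficient of $x^ry$ in the divided difference of $E_{i,j}$ is $-E_{i,j}^{(r)}$.
    have h3 := (h2.add h1) r 1
    rw [sub_add_cancel, cf_divDiff] at h3
    rcases Nat.eq_zero_or_pos r with rfl | hr
    · rw [gaussE, PowerSeries.coeff_zero_eq_constantCoeff_apply, map_mul, constantCoeff_schur M hM,
        if_neg (by rintro ⟨rfl, -⟩; exact lt_irrefl _ hij), mul_zero]
      exact zero_mem _
    · rw [if_pos ⟨hr, le_rfl⟩, Nat.add_sub_cancel] at h3
      have h4 := neg_mem h3
      rw [neg_neg] at h4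
      exact h4

end GaussE

end Yangian

namespace Yangian

/-! ### Words, the degree filtration and straightening -/

section Words

variable {R : Type*} [Ring R] [Algebra ℂ R] {I : Type*}

/-- The total degree of a word. -/
def wdeg (deg : I → ℕ) (w : List I) : ℕ := (w.map deg).sum

/-- The span of all words of total degree at most `d`. -/
def wordFil (x : I → R) (deg : I → ℕ) (d : ℕ) : Submodule ℂ R :=
  Submodule.span ℂ {y | ∃ w : List I, wdeg deg w ≤ d ∧ y = (w.map x).prod}

variable {x : I → R} {deg : I → ℕ}

theorem wdeg_cons (a : I) (w : List I) : wdeg deg (a :: w) = deg a + wdeg deg w := by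
  simp [wdeg]

theorem wdeg_append (w w' : List I) : wdeg deg (w ++ w') = wdeg deg w + wdeg deg w' := by
  simp [wdeg]

theorem wdeg_perm {w w' : List I} (h : w.Perm w') : wdeg deg w = wdeg deg w' :=
  (h.map deg).sum_eq

theorem prod_mem_wordFil {w : List I} {d : ℕ} (h : wdeg deg w ≤ d) :
    (w.map x).prod ∈ wordFil x deg d := Submodule.subset_span ⟨w, h, rfl⟩

theorem mem_wordFil (a : I) : x a ∈ wordFil x deg (deg a) := by
  simpa using prod_mem_wordFil (x := x) (w := [a]) (d := deg a) (by simp [wdeg])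

theorem isMulFiltration_wordFil (x : I → R) (deg : I → ℕ) : IsMulFiltration (wordFil x deg) where
  one_mem := by simpa using prod_mem_wordFil (x := x) (deg := deg) (w := []) (d := 0) (by simp [wdeg])
  mul_mem := by
    intro a b y z hy hz
    have := Submodule.mul_mem_mul hy hz
    rw [wordFil, wordFil, Submodule.span_mul_span] at this
    refine Submodule.span_mono ?_ this
    rintro _ ⟨_, ⟨w, hw, rfl⟩, _, ⟨w', hw', rfl⟩, rfl⟩
    exact ⟨w ++ w', by rw [wdeg_append]; omega, by simp⟩
  mono a b hab := Submodule.span_mono fun _ ⟨w, hw, h⟩ => ⟨w, hw.trans hab, h⟩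

theorem IsMulFiltration.prod_mem {V : ℕ → Submodule ℂ R} (hV : IsMulFiltration V)
    (hx : ∀ a, x a ∈ V (deg a)) (w : List I) : (w.map x).prod ∈ V (wdeg deg w) := by
  induction w with
  | nil => simpa [wdeg] using hV.one_mem
  | cons a w ih =>
    rw [List.map_cons, List.prod_cons, wdeg_cons]
    exact hV.mul_mem (hx a) ih

theorem wordFil_le {V : ℕ → Submodule ℂ R} (hV : IsMulFiltration V)
    (hx : ∀ a, x a ∈ V (deg a)) (d : ℕ) : wordFil x deg d ≤ V d := by
  refine Submodule.span_le.2 ?_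
  rintro _ ⟨w, hw, rfl⟩
  exact hV.mono hw (hV.prod_mem hx w)

theorem IsMulFiltration.predFil_mono {V : ℕ → Submodule ℂ R} (hV : IsMulFiltration V) :
    Monotone (predFil V) := by
  intro a b hab
  rcases a with _ | a
  · exact bot_le
  · obtain ⟨b, rfl⟩ : ∃ c, b = c + 1 := ⟨b - 1, by omega⟩
    exact hV.mono (by omega)

/-! ### Straightening when commutators of letters have lower degree -/

section Straighten

variable (hc : ∀ a b, x a * x b - x b * x a ∈ predFil (wordFil x deg) (deg a + deg b))

include hc

theorem prod_sub_prod_mem_of_perm {w w' : List I} (h : w.Perm w') :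
    (w.map x).prod - (w'.map x).prod ∈ predFil (wordFil x deg) (wdeg deg w) := by
  have hW := isMulFiltration_wordFil x deg
  induction h with
  | nil => simp
  | cons a h ih =>
    rw [List.map_cons, List.map_cons, List.prod_cons, List.prod_cons, ← mul_sub, wdeg_cons]
    exact hW.mul_predFil (mem_wordFil a) ih
  | swap a b l =>
    simp only [List.map_cons, List.prod_cons, ← mul_assoc, wdeg_cons]
    rw [← sub_mul, ← add_assoc]
    exact hW.predFil_mul (hc b a) (prod_mem_wordFil le_rfl)
  | trans h₁ h₂ ih₁ ih₂ =>
    rw [← wdeg_perm h₁] at ih₂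
    simpa using add_mem ih₁ ih₂

theorem wordFil_commutator_mem {a b : ℕ} {y z : R} (hy : y ∈ wordFil x deg a)
    (hz : z ∈ wordFil x deg b) : y * z - z * y ∈ predFil (wordFil x deg) (a + b) := by
  have hW := isMulFiltration_wordFil x deg
  induction hy using Submodule.span_induction with
  | mem y hy =>
    obtain ⟨w, hw, rfl⟩ := hy
    induction hz using Submodule.span_induction with
    | mem z hz =>
      obtain ⟨w', hw', rfl⟩ := hz
      have := prod_sub_prod_mem_of_perm hc (List.perm_append_comm (l₁ := w) (l₂ := w'))
      rw [List.map_append, List.map_append, List.prod_append, List.prod_append,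
        wdeg_append] at this
      exact hW.predFil_mono (by omega) this
    | zero => simp
    | add z₁ z₂ _ _ h₁ h₂ =>
      rw [mul_add, add_mul, add_sub_add_comm]
      exact add_mem h₁ h₂
    | smul c z _ h =>
      rw [mul_smul_comm, smul_mul_assoc, ← smul_sub]
      exact Submodule.smul_mem _ c h
  | zero => simp
  | add y₁ y₂ _ _ h₁ h₂ =>
    rw [mul_add, add_mul, add_sub_add_comm]
    exact add_mem h₁ h₂
  | smul c z _ h =>
    rw [mul_smul_comm, smul_mul_assoc, ← smul_sub]
    exact Submodule.smul_mem _ c h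

/-- Ordered words of degree at most `d` span all words of degree at most `d`. -/
theorem wordFil_le_span_ordered (le : I → I → Prop) [IsLinearOrder I le] (d : ℕ) :
    wordFil x deg d ≤
      Submodule.span ℂ {y | ∃ w : OrderedWord le, wdeg deg w.1 ≤ d ∧ y = (w.1.map x).prod} := by
  classical
  induction d using Nat.strong_induction_on with
  | _ d ih =>
    refine Submodule.span_le.2 ?_
    rintro _ ⟨w, hw, rfl⟩
    have hp := List.perm_insertionSort le w
    have h1 := prod_sub_prod_mem_of_perm hc hp.symm
    have h2 : ((List.insertionSort le w).map x).prod ∈ Submodule.span ℂ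
        {y | ∃ w : OrderedWord le, wdeg deg w.1 ≤ d ∧ y = (w.1.map x).prod} :=
      Submodule.subset_span ⟨⟨_, List.pairwise_insertionSort le w⟩,
        (wdeg_perm hp).le.trans hw, rfl⟩
    rw [← sub_add_cancel (w.map x).prod ((List.insertionSort le w).map x).prod]
    refine add_mem ?_ h2
    -- In degree $0$ the sorting correction lies in `⊥`, so it is zero; otherwise it lies in an
    -- earlier filtration step.
    rcases hd : wdeg deg w with _ | e
    · rw [hd] at h1
      rw [(Submodule.mem_bot ℂ).1 h1]
      exact zero_mem _
    · rw [hd] at h1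
      refine Submodule.span_mono ?_ (ih e (by omega) h1)
      rintro _ ⟨w', hw', rfl⟩
      exact ⟨w', by omega, rfl⟩

theorem span_ordered_eq_adjoin (le : I → I → Prop) [IsLinearOrder I le] :
    Submodule.span ℂ (Set.range fun w : OrderedWord le => (w.1.map x).prod) =
      Subalgebra.toSubmodule (Algebra.adjoin ℂ (Set.range x)) := by
  have hW := isMulFiltration_wordFil x deg
  apply le_antisymm
  · refine Submodule.span_le.2 ?_
    rintro _ ⟨w, rfl⟩
    refine Subalgebra.list_prod_mem _ fun y hy => ?_
    obtain ⟨a, -, rfl⟩ := List.mem_map.1 hy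
    exact Algebra.subset_adjoin ⟨a, rfl⟩
  · intro y hy
    have : ∃ d, y ∈ wordFil x deg d := by
      refine Algebra.adjoin_induction (p := fun y _ => ∃ d, y ∈ wordFil x deg d) ?_ ?_ ?_ ?_ hy
      · rintro _ ⟨a, rfl⟩
        exact ⟨_, mem_wordFil a⟩
      · intro c
        refine ⟨0, ?_⟩
        rw [Algebra.algebraMap_eq_smul_one]
        exact Submodule.smul_mem _ c hW.one_mem
      · rintro y z - - ⟨a, ha⟩ ⟨b, hb⟩
        exact ⟨max a b, add_mem (hW.mono (le_max_left _ _) ha) (hW.mono (le_max_right _ _) hb)⟩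
      · rintro y z - - ⟨a, ha⟩ ⟨b, hb⟩
        exact ⟨a + b, hW.mul_mem ha hb⟩
    obtain ⟨d, hd⟩ := this
    refine Submodule.span_mono ?_ (wordFil_le_span_ordered hc le d hd)
    rintro _ ⟨w, -, rfl⟩
    exact ⟨w, rfl⟩

end Straighten

theorem orderedMonomialsFormBasis_of {le : I → I → Prop} {S : Subalgebra ℂ R}
    (li : LinearIndependent ℂ (fun w : OrderedWord le => (w.1.map x).prod))
    (hs : Submodule.span ℂ (Set.range fun w : OrderedWord le => (w.1.map x).prod) =
      Subalgebra.toSubmodule S) : OrderedMonomialsFormBasis x le S := by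
  refine ⟨(Module.Basis.span li).map (LinearEquiv.ofEq _ _ hs), fun w => ?_⟩
  rw [Module.Basis.map_apply]
  exact congrArg Subtype.val (Module.Basis.span_apply li w) |>.trans rfl

end Words

end Yangian

namespace Yangian

/-! ### The universal property, the coproduct and evaluation -/

section Universal

variable {n : ℕ} {B : Type*} [Ring B] [Algebra ℂ B]

theorem T_zero (i j : Fin n) : T n i j 0 = if i = j then 1 else 0 := by
  simp only [T, freeT, lt_irrefl, dite_false]
  split_ifs <;> simp

theorem T_rel (i j h k : Fin n) (r s : ℕ) :
    ⁅T n i j (r + 1), T n h k s⁆ - ⁅T n i j r, T n h k (s + 1)⁆ =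
      T n h j r * T n i k s - T n h j s * T n i k r := by
  have := RingQuot.mkAlgHom_rel ℂ (Rel.rtt i j h k r s)
  simpa only [T, Ring.lie_def, map_sub, map_mul] using this

theorem isRTT_Tser (n : ℕ) : IsRTT (Tser n) := by
  intro i j h k r s
  simpa [Tser] using T_rel i j h k r s

/-- The homomorphism out of the Yangian defined by elements satisfying the RTT relations. -/
noncomputable def lift (m : Fin n → Fin n → ℕ → B)
    (h0 : ∀ i j, m i j 0 = if i = j then 1 else 0)
    (hm : ∀ i j h k r s, ⁅m i j (r + 1), m h k s⁆ - ⁅m i j r, m h k (s + 1)⁆ =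
      m h j r * m i k s - m h j s * m i k r) : Yangian n →ₐ[ℂ] B :=
  RingQuot.liftAlgHom ℂ ⟨FreeAlgebra.lift ℂ fun a => m a.1 a.2.1 a.2.2, by
    have hT : ∀ i j r, FreeAlgebra.lift ℂ (fun a : Fin n × Fin n × ℕ+ => m a.1 a.2.1 a.2.2)
        (freeT n i j r) = m i j r := by
      intro i j r
      unfold freeT
      split_ifs with h h'
      · rw [FreeAlgebra.lift_ι_apply]; rfl
      · obtain rfl : r = 0 := by omega
        rw [map_one, h0, if_pos h']
      · obtain rfl : r = 0 := by omega
        rw [map_zero, h0, if_neg h']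
    rintro _ _ ⟨i, j, h, k, r, s⟩
    simpa only [Ring.lie_def, map_sub, map_mul, hT] using hm i j h k r s⟩

theorem lift_T (m : Fin n → Fin n → ℕ → B) (h0 : ∀ i j, m i j 0 = if i = j then 1 else 0)
    (hm : ∀ i j h k r s, ⁅m i j (r + 1), m h k s⁆ - ⁅m i j r, m h k (s + 1)⁆ =
      m h j r * m i k s - m h j s * m i k r) (i j : Fin n) (r : ℕ) :
    lift m h0 hm (T n i j r) = m i j r := by
  rw [lift, T, RingQuot.liftAlgHom_mkAlgHom_apply]
  unfold freeT
  split_ifs with h hij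
  · rw [FreeAlgebra.lift_ι_apply]; rfl
  · obtain rfl : r = 0 := by omega
    rw [map_one, h0, if_pos hij]
  · obtain rfl : r = 0 := by omega
    rw [map_zero, h0, if_neg hij]

/-- The counit `T(u) ↦ 1`. -/
noncomputable def counit (n : ℕ) : Yangian n →ₐ[ℂ] ℂ :=
  lift (fun i j r => if r = 0 then if i = j then 1 else 0 else 0) (fun i j => by simp) (by
    intro i j h k r s
    rcases r with _ | r <;> rcases s with _ | s <;> simp [Ring.lie_def, mul_comm])

/-- The matrix unit `e_{i,j}`, paired with `0`. -/
noncomputable def matUnit (i j : Fin n) : Matrix (Fin n) (Fin n) ℂ × ℂ := (Matrix.single i j 1, 0)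

theorem matUnit_mul (i j h k : Fin n) :
    matUnit i j * matUnit h k = if j = h then matUnit i k else 0 := by
  unfold matUnit
  rw [Prod.mk_mul_mk, mul_zero]
  split_ifs with hj
  · subst hj; simp
  · rw [Matrix.single_mul_single_of_ne _ _ _ _ hj]; rfl

/-- The evaluation `T_{i,j}^{(r)} ↦ t ^ (r - 1) e_{i,j}` for `r ≥ 1`. -/
noncomputable def eval (n : ℕ) : Yangian n →ₐ[ℂ] Polynomial (Matrix (Fin n) (Fin n) ℂ × ℂ) :=
  lift (fun i j r => if r = 0 then if i = j then 1 else 0 else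
    Polynomial.monomial (r - 1) (matUnit i j)) (fun i j => by simp) (by
    -- The series is $\delta_{ij}+e_{ij}/(u-t)$. If one of $r,s$ is $0$ and the other is not, the
    -- relation is the commutator of matrix units. If both are positive, the two commutators on the
    -- left cancel, as do the two products on the right.
    intro i j h k r s
    rcases r with _ | r <;> rcases s with _ | s
    · simp only [Ring.lie_def]
      split_ifs <;> simp
    · rcases eq_or_ne j h with rfl | h1 <;> rcases eq_or_ne k i with rfl | h2 <;>
        [skip; have h2' := h2.symm; have h1' := h1.symm; (have h1' := h1.symm; have h2' := h2.symm)] <;>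
        simp [Ring.lie_def, matUnit_mul, *]
    · rcases eq_or_ne j h with rfl | h1 <;> rcases eq_or_ne k i with rfl | h2 <;>
        [skip; have h2' := h2.symm; have h1' := h1.symm; (have h1' := h1.symm; have h2' := h2.symm)] <;>
        simp [Ring.lie_def, matUnit_mul, *]
    · simp [Ring.lie_def, Polynomial.monomial_mul_monomial, add_comm, add_left_comm])

theorem eval_T (i j : Fin n) (r : ℕ) (hr : r ≠ 0) :
    eval n (T n i j r) = Polynomial.monomial (r - 1) (matUnit i j) := by
  rw [eval, lift_T, if_neg hr]

end Universal

end Yangian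

namespace Yangian

/-! ### The coproduct and its leading terms in the loop degree -/

section Coproduct

variable {n : ℕ}

theorem IsRTT.map {R S : Type*} [Ring R] [Ring S] {ι : Type*} {M : ι → ι → PowerSeries R}
    (H : IsRTT M) (f : R →+* S) : IsRTT fun i j => PowerSeries.map f (M i j) := by
  intro i j h k r s
  have := congrArg f (H i j h k r s)
  simpa only [Ring.lie_def, PowerSeries.coeff_map, map_sub, map_mul] using this

/-- The image of `T(u)` under a homomorphism. -/
noncomputable def mapTser {B : Type*} [Ring B] (f : Yangian n →+* B) (i j : Fin n) :
    PowerSeries B := PowerSeries.map f (Tser n i j)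

theorem coeff_mapTser {B : Type*} [Ring B] (f : Yangian n →+* B) (i j : Fin n) (r : ℕ) :
    PowerSeries.coeff r (mapTser f i j) = f (T n i j r) := by
  simp [mapTser, Tser]

theorem mapTser_pair {B : Type*} [Ring B] (f : Yangian n →+* B) :
    RTTPair (alphaC : Subring.center (TwoVar B)) betaC
      (fun i j => serX (mapTser f i j)) (fun i j => serY (mapTser f i j)) := by
  refine ((isRTT_Tser n).map f).pair fun i j x => ?_
  change PowerSeries.coeff 0 (mapTser f i j) * x = x * PowerSeries.coeff 0 (mapTser f i j)
  rw [coeff_mapTser, T_zero]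
  split_ifs <;> simp

/-- Products of matrices `T(u)` with commuting entries satisfy the RTT relation. -/
theorem isRTT_mul {B : Type*} [Ring B] (f g : Yangian n →+* B)
    (hfg : ∀ x y, g x * f y = f y * g x) :
    IsRTT fun i j => ∑ p, mapTser f i p * mapTser g p j := by
  refine IsRTT.of_std fun i j h k => ?_
  simp only [map_sum, map_mul]
  refine (mapTser_pair f).std_mul (mapTser_pair g) ?_ ?_ i j h k
  · intro i j h k
    refine ext_cf fun r s => ?_
    rw [cf_serX_mul, cf_serY_mul, coeff_mapTser, coeff_mapTser, hfg]
  · intro i j h k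
    refine ext_cf fun r s => ?_
    rw [cf_serX_mul, cf_serY_mul, coeff_mapTser, coeff_mapTser, hfg]

/-- The convolution product of two homomorphisms with commuting images. -/
noncomputable def convolution {B : Type*} [Ring B] [Algebra ℂ B] (f g : Yangian n →ₐ[ℂ] B)
    (hfg : ∀ x y, g x * f y = f y * g x) : Yangian n →ₐ[ℂ] B :=
  lift (fun i j r => ∑ p, ∑ q ∈ Finset.HasAntidiagonal.antidiagonal r,
      f (T n i p q.1) * g (T n p j q.2))
    (fun i j => by
      simp only [Finset.Nat.antidiagonal_zero, Finset.sum_singleton, T_zero]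
      rw [Finset.sum_eq_single i]
      · rw [if_pos rfl, map_one, one_mul]
        split_ifs <;> simp
      · intro p _ hp
        rw [if_neg hp.symm, map_zero, zero_mul]
      · simp)
    (fun i j h k r s => by
      have := isRTT_mul (f : Yangian n →+* B) (g : Yangian n →+* B) hfg i j h k r s
      simpa only [map_sum, PowerSeries.coeff_mul, coeff_mapTser, RingHom.coe_coe] using this)

theorem convolution_T {B : Type*} [Ring B] [Algebra ℂ B] (f g : Yangian n →ₐ[ℂ] B)
    (hfg : ∀ x y, g x * f y = f y * g x) (i j : Fin n) (r : ℕ) :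
    convolution f g hfg (T n i j r) = ∑ p, ∑ q ∈ Finset.HasAntidiagonal.antidiagonal r,
      f (T n i p q.1) * g (T n p j q.2) := by
  rw [convolution, lift_T]

/-! The coproduct is studied on an isomorphic copy `U` of the Yangian. -/

variable {U : Type*} [Ring U] [Algebra ℂ U] (e : Yangian n ≃ₐ[ℂ] U)

/-- The coproduct `T(u) ↦ T(u) ⊗ T(u)`. -/
noncomputable def comul : U →ₐ[ℂ] U ⊗[ℂ] U :=
  (convolution (Algebra.TensorProduct.includeLeft.comp e.toAlgHom)
    (Algebra.TensorProduct.includeRight.comp e.toAlgHom) fun x y => by simp).comp e.symm.toAlgHom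

/-- The image of `T_{i,j}^{(r)}` in `U`. -/
noncomputable def xT (i j : Fin n) (r : ℕ) : U := e (T n i j r)

theorem xT_zero (i j : Fin n) : xT e i j 0 = if i = j then 1 else 0 := by
  rw [xT, T_zero]
  split_ifs <;> simp

theorem comul_T (i j : Fin n) (r : ℕ) : comul e (xT e i j r) =
    ∑ p, ∑ q ∈ Finset.HasAntidiagonal.antidiagonal r, xT e i p q.1 ⊗ₜ[ℂ] xT e p j q.2 := by
  have h : e.symm.toAlgHom (xT e i j r) = T n i j r := e.symm_apply_apply _
  rw [comul, AlgHom.comp_apply, h, convolution_T]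
  simp [xT]

/-- Index set of the `T_{i,j}^{(r)}`, `r ≥ 1`. -/
abbrev TIndex (n : ℕ) : Type := Fin n × Fin n × ℕ+

/-- The family of all `T_{i,j}^{(r)}`, `r ≥ 1`. -/
noncomputable def xFam (a : TIndex n) : U := xT e a.1 a.2.1 a.2.2

/-- The loop degree `r - 1` of `T_{i,j}^{(r)}`. -/
def loopDeg (a : TIndex n) : ℕ := a.2.2 - 1

/-- The product of the letters of a word. -/
noncomputable def tWord (w : List (TIndex n)) : U := (w.map (xFam e)).prod

theorem tWord_cons (a : TIndex n) (w : List (TIndex n)) :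
    tWord e (a :: w) = xFam e a * tWord e w := by simp [tWord]

theorem tWord_append (w w' : List (TIndex n)) :
    tWord e (w ++ w') = tWord e w * tWord e w' := by simp [tWord]

theorem tWord_nil : tWord e ([] : List (TIndex n)) = 1 := rfl

theorem tWord_singleton (a : TIndex n) : tWord e [a] = xFam e a := by simp [tWord]

/-- The span of the tensors `u ⊗ v` of words with `p u v`. -/
def tensorSpan (p : List (TIndex n) → List (TIndex n) → Prop) :
    Submodule ℂ (U ⊗[ℂ] U) :=
  Submodule.span ℂ {z | ∃ u v, p u v ∧ z = tWord e u ⊗ₜ[ℂ] tWord e v}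

theorem tmul_mem_tensorSpan {p : List (TIndex n) → List (TIndex n) → Prop}
    {u v : List (TIndex n)} (h : p u v) : tWord e u ⊗ₜ[ℂ] tWord e v ∈ tensorSpan e p :=
  Submodule.subset_span ⟨u, v, h, rfl⟩

theorem mul_mem_tensorSpan {p q r : List (TIndex n) → List (TIndex n) → Prop}
    (h : ∀ u v u' v', p u v → q u' v' → r (u ++ u') (v ++ v')) {y z : U ⊗[ℂ] U}
    (hy : y ∈ tensorSpan e p) (hz : z ∈ tensorSpan e q) : y * z ∈ tensorSpan e r := by
  have := Submodule.mul_mem_mul hy hz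
  rw [tensorSpan, tensorSpan, Submodule.span_mul_span] at this
  refine Submodule.span_mono ?_ this
  rintro _ ⟨_, ⟨u, v, hw, rfl⟩, _, ⟨u', v', hw', rfl⟩, rfl⟩
  exact ⟨_, _, h _ _ _ _ hw hw', by simp [tWord_append]⟩

theorem tensorSpan_mono {p q : List (TIndex n) → List (TIndex n) → Prop}
    (h : ∀ u v, p u v → q u v) : tensorSpan e p ≤ tensorSpan e q :=
  Submodule.span_mono fun _ ⟨u, v, hp, hz⟩ => ⟨u, v, h u v hp, hz⟩

/-- The coproduct is primitive up to terms of lower loop degree. -/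
theorem comul_xFam (a : TIndex n) :
    comul e (xFam e a) - (xFam e a ⊗ₜ[ℂ] 1 + 1 ⊗ₜ[ℂ] xFam e a) ∈
      tensorSpan e (fun u v => wdeg loopDeg u + wdeg loopDeg v < loopDeg a) := by
  obtain ⟨i, j, r⟩ := a
  obtain ⟨r, hr⟩ := r
  obtain ⟨r, rfl⟩ : ∃ s, r = s + 1 := ⟨r - 1, by omega⟩
  simp only [xFam, PNat.mk_coe, loopDeg]
  rw [comul_T, Finset.sum_comm, Finset.Nat.antidiagonal_succ, Finset.sum_cons, Finset.sum_map]
  have h1 : ∑ p, xT e i p (0, r + 1).1 ⊗ₜ[ℂ] xT e p j (0, r + 1).2 =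
      1 ⊗ₜ[ℂ] xT e i j (r + 1) := by
    simp only [xT_zero]
    rw [Finset.sum_eq_single i]
    · rw [if_pos rfl]
    · intro p _ hp
      rw [if_neg hp.symm, TensorProduct.zero_tmul]
    · simp
  rw [h1, add_comm (xT e i j (r + 1) ⊗ₜ[ℂ] 1), add_sub_add_left_eq_sub]
  -- With the term $1\otimes T^{(r+1)}$ split off, the index $(r,0)$ gives $T^{(r+1)}\otimes1$. All
  -- other terms have both superscripts positive, so each factor loses one and the loop degree drops
  -- strictly.
  have h2 : ∀ q ∈ Finset.HasAntidiagonal.antidiagonal r,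
      (∑ p, xT e i p (q.1 + 1) ⊗ₜ[ℂ] xT e p j q.2) -
        (if q = (r, 0) then xT e i j (r + 1) ⊗ₜ[ℂ] 1 else 0) ∈
      tensorSpan e (fun u v => wdeg loopDeg u + wdeg loopDeg v < r + 1 - 1) := by
    rintro ⟨s, t⟩ hst
    rw [Finset.HasAntidiagonal.mem_antidiagonal] at hst
    simp only at hst ⊢
    rcases t with _ | t
    · obtain rfl : s = r := by omega
      rw [if_pos rfl, Finset.sum_eq_single j]
      · rw [xT_zero, if_pos rfl, sub_self]; exact zero_mem _
      · intro p _ hp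
        rw [xT_zero, if_neg hp, TensorProduct.tmul_zero]
      · simp
    · rw [if_neg (by simp), sub_zero]
      refine Submodule.sum_mem _ fun p _ => ?_
      have := tmul_mem_tensorSpan e
        (p := fun u v => wdeg loopDeg u + wdeg loopDeg v < r + 1 - 1)
        (u := [((i, p, ⟨s + 1, by omega⟩) : TIndex n)])
        (v := [((p, j, ⟨t + 1, by omega⟩) : TIndex n)]) (by simp [wdeg, loopDeg]; omega)
      simpa only [tWord_singleton, xFam, PNat.mk_coe] using this
  have h3 := Submodule.sum_mem _ h2
  rw [Finset.sum_sub_distrib, Finset.sum_ite_eq' ] at h3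
  rw [if_pos (by simp)] at h3
  exact h3

/-- The part of the coproduct of a word that is linear in the left factor. -/
noncomputable def linPart (w : List (TIndex n)) : U ⊗[ℂ] U :=
  ∑ m : Fin w.length, xFam e w[m] ⊗ₜ[ℂ] tWord e (w.eraseIdx m)

theorem linPart_cons (a : TIndex n) (w : List (TIndex n)) :
    linPart e (a :: w) = xFam e a ⊗ₜ[ℂ] tWord e w + (1 ⊗ₜ[ℂ] xFam e a) * linPart e w := by
  simp only [linPart, List.length_cons]
  rw [Fin.sum_univ_succ, Finset.mul_sum]
  congr 1
  refine Finset.sum_congr rfl fun m _ => ?_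
  simp [tWord_cons]

theorem linPart_mem (w : List (TIndex n)) : linPart e w ∈ tensorSpan e fun u v =>
    wdeg loopDeg u + wdeg loopDeg v ≤ wdeg loopDeg w ∧ 1 ≤ u.length ∧
      u.length + v.length ≤ w.length := by
  refine Submodule.sum_mem _ fun m _ => ?_
  rw [← tWord_singleton]
  have hp := List.getElem_cons_eraseIdx_perm m.2
  have h1 := wdeg_perm (deg := loopDeg) hp
  have h2 := hp.length_eq
  rw [wdeg_cons] at h1
  rw [List.length_cons] at h2
  refine tmul_mem_tensorSpan e ⟨?_, by simp, by simp; omega⟩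
  rw [wdeg_cons]
  simp [wdeg] at h1 ⊢
  omega

/-- Multiply the almost primitive coproducts of the letters. A term of full degree with at least two
letters on the left leaves too few letters on the right, so the functionals below ignore it; this is
why the length bound is kept. -/
theorem comul_tWord (w : List (TIndex n)) :
    comul e (tWord e w) - (1 ⊗ₜ[ℂ] tWord e w + linPart e w) ∈ tensorSpan e fun u v =>
      wdeg loopDeg u + wdeg loopDeg v < wdeg loopDeg w ∨
      (wdeg loopDeg u + wdeg loopDeg v ≤ wdeg loopDeg w ∧ 2 ≤ u.length ∧
        u.length + v.length ≤ w.length) := by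
  induction w with
  | nil =>
    simp [tWord_nil, linPart, Algebra.TensorProduct.one_def]
  | cons a w ih =>
    set q := comul e (tWord e w) - (1 ⊗ₜ[ℂ] tWord e w + linPart e w) with hq
    set l := comul e (xFam e a) - (xFam e a ⊗ₜ[ℂ] 1 + 1 ⊗ₜ[ℂ] xFam e a) with hl
    have hl' := comul_xFam e a
    rw [← hl] at hl'
    have key : comul e (tWord e (a :: w)) - (1 ⊗ₜ[ℂ] tWord e (a :: w) + linPart e (a :: w)) =
        xFam e a ⊗ₜ[ℂ] 1 * linPart e w + (xFam e a ⊗ₜ[ℂ] 1 + 1 ⊗ₜ[ℂ] xFam e a) * q +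
          l * (1 ⊗ₜ[ℂ] tWord e w + linPart e w + q) := by
      have e1 : comul e (tWord e w) = q + (1 ⊗ₜ[ℂ] tWord e w + linPart e w) := by rw [hq]; abel
      have e2 : comul e (xFam e a) = l + (xFam e a ⊗ₜ[ℂ] 1 + 1 ⊗ₜ[ℂ] xFam e a) := by rw [hl]; abel
      have e3 : (1 : U) ⊗ₜ[ℂ] (xFam e a * tWord e w) =
        1 ⊗ₜ[ℂ] xFam e a * 1 ⊗ₜ[ℂ] tWord e w := by simp
      have e4 : xFam e a ⊗ₜ[ℂ] tWord e w = xFam e a ⊗ₜ[ℂ] 1 * 1 ⊗ₜ[ℂ] tWord e w := by simp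
      rw [linPart_cons, tWord_cons, map_mul, e1, e2, e3, e4]
      noncomm_ring
    rw [key]
    have ha1 : xFam e a ⊗ₜ[ℂ] 1 ∈ tensorSpan e fun u v => u = [a] ∧ v = [] := by
      have := tmul_mem_tensorSpan e (p := fun u v => u = [a] ∧ v = []) ⟨rfl, rfl⟩
      rwa [tWord_singleton, tWord_nil] at this
    have ha2 : 1 ⊗ₜ[ℂ] xFam e a ∈ tensorSpan e fun u v => u = [] ∧ v = [a] := by
      have := tmul_mem_tensorSpan e (p := fun u v => u = [] ∧ v = [a]) ⟨rfl, rfl⟩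
      rwa [tWord_singleton, tWord_nil] at this
    have hw : 1 ⊗ₜ[ℂ] tWord e w ∈ tensorSpan e fun u v =>
        wdeg loopDeg u + wdeg loopDeg v ≤ wdeg loopDeg w := by
      rw [← tWord_nil]
      exact tmul_mem_tensorSpan e (by simp [wdeg])
    have hlin := linPart_mem e w
    refine add_mem (add_mem ?_ ?_) ?_
    · refine mul_mem_tensorSpan e ?_ ha1 hlin
      rintro u v u' v' ⟨rfl, rfl⟩ h
      simp [wdeg_cons] at h ⊢
      omega
    · rw [add_mul]
      refine add_mem (mul_mem_tensorSpan e ?_ ha1 ih) (mul_mem_tensorSpan e ?_ ha2 ih)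
      · rintro u v u' v' ⟨rfl, rfl⟩ h
        simp [wdeg_cons] at h ⊢
        omega
      · rintro u v u' v' ⟨rfl, rfl⟩ h
        simp [wdeg_cons] at h ⊢
        omega
    · have : 1 ⊗ₜ[ℂ] tWord e w + linPart e w + q ∈ tensorSpan e fun u v =>
          wdeg loopDeg u + wdeg loopDeg v ≤ wdeg loopDeg w :=
        add_mem (add_mem hw (tensorSpan_mono e (fun u v h => h.1) hlin))
          (tensorSpan_mono e (fun u v h => by omega) ih)
      refine mul_mem_tensorSpan e ?_ hl' this
      intro u v u' v' h h'
      simp only [wdeg_append, wdeg_cons] at h h' ⊢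
      omega

end Coproduct

end Yangian

namespace Yangian

/-! ### Functionals separating words -/

section Functionals

variable {n : ℕ} {U : Type*} [Ring U] [Algebra ℂ U] (e : Yangian n ≃ₐ[ℂ] U)

/-- The matrix coefficient of the evaluation homomorphism attached to the letter `t`. -/
noncomputable def letterFun (t : TIndex n) : U →ₗ[ℂ] ℂ where
  -- The second coordinate is $1$ on the unit and $0$ on the images of letters. Subtracting it makes
  -- the functional vanish at $1$ without changing its values on letters.
  toFun y := ((eval n (e.symm y)).coeff (loopDeg t)).1 t.1 t.2.1 -
    if t.1 = t.2.1 then ((eval n (e.symm y)).coeff (loopDeg t)).2 else 0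
  map_add' y z := by
    simp only [map_add, Polynomial.coeff_add, Prod.fst_add, Prod.snd_add, Matrix.add_apply]
    split_ifs <;> ring
  map_smul' c y := by
    simp only [map_smul, Polynomial.coeff_smul, Prod.smul_fst, Prod.smul_snd, Matrix.smul_apply,
      smul_eq_mul, RingHom.id_apply]
    split_ifs <;> ring

theorem letterFun_one (t : TIndex n) : letterFun e t 1 = 0 := by
  simp only [letterFun, LinearMap.coe_mk, AddHom.coe_mk, map_one, Polynomial.coeff_one]
  by_cases h : loopDeg t = 0
  · simp [h, Matrix.one_apply]
  · simp [h]

theorem eval_xFam (a : TIndex n) : eval n (e.symm (xFam e a)) =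
    Polynomial.monomial (loopDeg a) (matUnit a.1 a.2.1) := by
  rw [xFam, xT, e.symm_apply_apply, eval_T _ _ _ a.2.2.ne_zero, loopDeg]

theorem eval_tWord (w : List (TIndex n)) : ∃ m, eval n (e.symm (tWord e w)) =
    Polynomial.monomial (wdeg loopDeg w) m := by
  induction w with
  | nil => exact ⟨1, by simp [tWord_nil, wdeg]⟩
  | cons a w ih =>
    obtain ⟨m, hm⟩ := ih
    exact ⟨_, by rw [tWord_cons, map_mul, map_mul, hm, eval_xFam,
      Polynomial.monomial_mul_monomial, wdeg_cons]⟩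

theorem letterFun_tWord (t : TIndex n) (w : List (TIndex n)) (h : wdeg loopDeg w ≠ loopDeg t) :
    letterFun e t (tWord e w) = 0 := by
  obtain ⟨m, hm⟩ := eval_tWord e w
  simp [letterFun, hm, Polynomial.coeff_monomial, h]

theorem letterFun_xFam (t a : TIndex n) :
    letterFun e t (xFam e a) = if a = t then 1 else 0 := by
  simp only [letterFun, LinearMap.coe_mk, AddHom.coe_mk, eval_xFam, Polynomial.coeff_monomial]
  by_cases h : loopDeg a = loopDeg t
  · rw [if_pos h]
    have h' : a.2.2 = t.2.2 := by
      have h1 := a.2.2.pos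
      have h2 := t.2.2.pos
      unfold loopDeg at h
      exact PNat.eq (by omega)
    have : a = t ↔ a.1 = t.1 ∧ a.2.1 = t.2.1 := by
      rw [Prod.ext_iff, Prod.ext_iff]; tauto
    simp only [matUnit, ite_self, sub_zero, this, Matrix.single_apply]
  · have hat : a ≠ t := fun hat => h (by rw [hat])
    simp [h, hat]

/-- The functional attached to a list of letters by iterating the coproduct. -/
noncomputable def wordFun : List (TIndex n) → (U →ₗ[ℂ] ℂ)
  | [] => (counit n).toLinearMap ∘ₗ e.symm.toLinearMap
  | t :: τ => LinearMap.mul' ℂ ℂ ∘ₗ TensorProduct.map (letterFun e t) (wordFun τ) ∘ₗ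
      (comul e).toLinearMap

/-- On words of smaller degree or equal degree and no greater length, `wordFun τ` detects the
rearrangements of `τ`. -/
theorem wordFun_tWord (τ : List (TIndex n)) : ∃ c : ℂ, c ≠ 0 ∧ ∀ w : List (TIndex n),
    (wdeg loopDeg w < wdeg loopDeg τ ∨
      (wdeg loopDeg w ≤ wdeg loopDeg τ ∧ w.length ≤ τ.length)) →
    ((w.Perm τ → wordFun e τ (tWord e w) = c) ∧ (¬ w.Perm τ → wordFun e τ (tWord e w) = 0)) := by
  induction τ with
  | nil =>
    refine ⟨1, one_ne_zero, fun w hw => ?_⟩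
    have : w = [] := by
      rw [show wdeg loopDeg ([] : List (TIndex n)) = 0 from rfl, List.length_nil] at hw
      exact List.length_eq_zero_iff.1 (by omega)
    subst this
    simp [wordFun, tWord_nil]
  | cons t τ ih =>
    obtain ⟨c, hc, ih⟩ := ih
    -- Each occurrence of $t$ in the word may be the letter split off to the left. Over the whole
    -- recursion the constant is the product of the factorials of the multiplicities.
    refine ⟨((t :: τ).count t : ℕ) * c, mul_ne_zero (by simp; norm_cast) hc, fun w hw => ?_⟩
    rw [wdeg_cons, List.length_cons] at hw
    set Ψ : U ⊗[ℂ] U →ₗ[ℂ] ℂ := LinearMap.mul' ℂ ℂ ∘ₗ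
      TensorProduct.map (letterFun e t) (wordFun e τ) with hΨ
    have hΨt : ∀ u v, Ψ (u ⊗ₜ v) = letterFun e t u * wordFun e τ v := fun u v => by simp [hΨ]
    have h0 : wordFun e (t :: τ) (tWord e w) = Ψ (comul e (tWord e w)) := rfl
    have h1 : Ψ (comul e (tWord e w) - (1 ⊗ₜ[ℂ] tWord e w + linPart e w)) = 0 := by
      have := comul_tWord e w
      refine (Submodule.span_le.2 ?_ : _ ≤ LinearMap.ker Ψ) this
      rintro _ ⟨u, v, huv, rfl⟩
      rw [SetLike.mem_coe, LinearMap.mem_ker, hΨt]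
      -- If $u$ has the loop degree of $t$, then $v$ has smaller degree than $\tau$, or no larger
      -- degree and fewer letters. In either case it is no rearrangement of $\tau$.
      by_cases hu : wdeg loopDeg u = loopDeg t
      · rw [(ih v (by omega)).2, mul_zero]
        intro hp
        have h2 := wdeg_perm (deg := loopDeg) hp
        have h3 := hp.length_eq
        omega
      · rw [letterFun_tWord e t u hu, zero_mul]
    have h2 : wordFun e (t :: τ) (tWord e w) = Ψ (linPart e w) := by
      rw [map_sub, sub_eq_zero, map_add, hΨt, letterFun_one, zero_mul, zero_add] at h1
      rw [h0, h1]
    have hp : ∀ m : Fin w.length, (w[m] :: w.eraseIdx m).Perm w := fun m =>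
      List.getElem_cons_eraseIdx_perm m.2
    have h3 : Ψ (linPart e w) = ∑ m : Fin w.length,
        (if w[m] = t then 1 else 0) * wordFun e τ (tWord e (w.eraseIdx m)) := by
      simp only [linPart, map_sum, hΨt, letterFun_xFam]
    have h4 : ∀ m : Fin w.length, w[m] = t →
        (wdeg loopDeg (w.eraseIdx m) < wdeg loopDeg τ ∨
        (wdeg loopDeg (w.eraseIdx m) ≤ wdeg loopDeg τ ∧
          (w.eraseIdx m).length ≤ τ.length)) := by
      intro m hm
      have h5 := wdeg_perm (deg := loopDeg) (hp m)
      have h6 := (hp m).length_eq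
      rw [wdeg_cons, hm] at h5
      rw [List.length_cons] at h6
      omega
    have h5 : ∀ m : Fin w.length, w[m] = t →
        ((w.eraseIdx m).Perm τ ↔ w.Perm (t :: τ)) := by
      intro m hm
      rw [← List.perm_cons t, ← hm]
      exact ⟨fun h => (hp m).symm.trans h, fun h => (hp m).trans h⟩
    rw [h2, h3]
    constructor
    · intro hw'
      have : ∀ m : Fin w.length,
          (if w[m] = t then 1 else 0) * wordFun e τ (tWord e (w.eraseIdx m)) =
          (if w[m] = t then c else 0) := by
        intro m
        split_ifs with hm
        · rw [one_mul, (ih _ (h4 m hm)).1 ((h5 m hm).2 hw')]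
        · rw [zero_mul]
      simp only [this]
      have h6 := Fin.sum_univ_fun_getElem w (fun a => if a = t then c else 0)
      refine h6.trans ?_
      rw [← hw'.count_eq t, ← nsmul_eq_mul, List.sum_map_ite_eq, sub_zero, List.sum_map_zero, add_zero]
      congr 1
      exact List.countP_congr (by simp)
    · intro hw'
      refine Finset.sum_eq_zero fun m _ => ?_
      split_ifs with hm
      · rw [(ih _ (h4 m hm)).2 (fun h => hw' ((h5 m hm).1 h)), mul_zero]
      · rw [zero_mul]

/-- Words in the `T_{i,j}^{(r)}` that are pairwise not rearrangements of each other are linearly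
independent. -/
theorem linearIndependent_tWord {W : Type*} (f : W → List (TIndex n))
    (hf : ∀ w w', (f w).Perm (f w') → w = w') :
    LinearIndependent ℂ fun w => tWord e (f w) := by
  classical
  rw [linearIndependent_iff]
  intro l hl
  by_contra hne
  have hs : l.support.Nonempty := Finsupp.support_nonempty_iff.2 hne
  -- A word in the support that is maximal first in degree, then in length, puts all the others
  -- within the range where its functional is controlled.
  obtain ⟨w₀, hw₀, hmax⟩ := Finset.exists_max_image l.support
    (fun w => toLex (wdeg loopDeg (f w), (f w).length)) hs
  obtain ⟨c, hc, h⟩ := wordFun_tWord e (f w₀)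
  have h1 := congrArg (wordFun e (f w₀)) hl
  rw [Finsupp.linearCombination_apply, Finsupp.sum, map_sum, map_zero,
    Finset.sum_eq_single w₀] at h1
  · rw [map_smul, (h (f w₀) (Or.inr ⟨le_rfl, le_rfl⟩)).1 (List.Perm.refl _), smul_eq_mul] at h1
    rcases mul_eq_zero.1 h1 with h2 | h2
    · exact Finsupp.mem_support_iff.1 hw₀ h2
    · exact hc h2
  · intro w hw hne
    have h2 := hmax w hw
    rw [Prod.Lex.toLex_le_toLex] at h2
    rw [map_smul, (h (f w) (by simp only at h2; omega)).2 (fun hp => hne (hf _ _ hp)), smul_zero]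
  · intro h2; exact absurd hw₀ h2

end Functionals

end Yangian

namespace Yangian

/-! ### Power series compatible with a filtration -/

section SeriesFiltration

variable {R : Type*} [Ring R] [Algebra ℂ R] {V : ℕ → Submodule ℂ R} (hV : IsMulFiltration V)

/-- The `r`-th coefficient lies in the `r`-th step of the filtration. -/
def SerIn (V : ℕ → Submodule ℂ R) (f : PowerSeries R) : Prop := ∀ r, PowerSeries.coeff r f ∈ V r

theorem SerIn.sub {f g : PowerSeries R} (hf : SerIn V f) (hg : SerIn V g) : SerIn V (f - g) :=
  fun r => by rw [map_sub]; exact sub_mem (hf r) (hg r)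

theorem SerIn.sum {ι : Type*} {s : Finset ι} {f : ι → PowerSeries R}
    (hf : ∀ i ∈ s, SerIn V (f i)) : SerIn V (∑ i ∈ s, f i) :=
  fun r => by rw [map_sum]; exact Submodule.sum_mem _ fun i hi => hf i hi r

theorem SerIn.zero : SerIn V 0 := fun r => by rw [map_zero]; exact zero_mem _

include hV

theorem SerIn.one : SerIn V 1 := fun r => by
  rw [PowerSeries.coeff_one]
  split_ifs with h
  · subst h; exact hV.one_mem
  · exact zero_mem _

theorem SerIn.mul {f g : PowerSeries R} (hf : SerIn V f) (hg : SerIn V g) : SerIn V (f * g) :=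
  fun r => by
    rw [PowerSeries.coeff_mul]
    refine Submodule.sum_mem _ fun p hp => ?_
    rw [Finset.HasAntidiagonal.mem_antidiagonal] at hp
    rw [← hp]
    exact hV.mul_mem (hf _) (hg _)

theorem SerIn.invSer {f : PowerSeries R} (hf : SerIn V f) : SerIn V (invSer f) := by
  intro r
  induction r using Nat.strong_induction_on with
  | _ r ih =>
    rw [Yangian.invSer, PowerSeries.coeff_invOfUnit]
    split_ifs with h
    · subst h; simpa using hV.one_mem
    · rw [inv_one, Units.val_one, neg_one_mul]
      refine neg_mem (Submodule.sum_mem _ fun p hp => ?_)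
      rw [Finset.HasAntidiagonal.mem_antidiagonal] at hp
      split_ifs with h'
      · rw [← hp]
        exact hV.mul_mem (hf _) (ih _ h')
      · exact zero_mem _

variable {n : ℕ} {M : Matrix (Fin n) (Fin n) (PowerSeries R)} (hM : ∀ i j, SerIn V (M i j))

include hM

theorem serIn_schur (k : ℕ) (i j : Fin n) : SerIn V (schur M k i j) := by
  induction k generalizing i j with
  | zero => exact hM i j
  | succ k ih =>
    simp only [schur, Matrix.of_apply]
    split_ifs with hk
    · exact (ih i j).sub (((ih _ _).mul hV ((ih _ _).invSer hV)).mul hV (ih _ _))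
    · exact ih i j

theorem serIn_gaussD (i : Fin n) : SerIn V (gaussD M i) := serIn_schur hV hM i i i

theorem serIn_gaussE (i j : Fin n) : SerIn V (gaussE M i j) :=
  ((serIn_gaussD hV hM i).invSer hV).mul hV (serIn_schur hV hM i i j)

theorem serIn_gaussF (i j : Fin n) : SerIn V (gaussF M i j) :=
  (serIn_schur hV hM i j i).mul hV ((serIn_gaussD hV hM i).invSer hV)

end SeriesFiltration

/-! ### The filtration of the Yangian with `T_{i,j}^{(r)}` in degree `r` -/

section YangianFiltration

variable {n : ℕ}

/-- The family of all `T_{i,j}^{(r)}`, `r ≥ 1`. -/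
noncomputable def tFam (n : ℕ) (a : TIndex n) : Yangian n := T n a.1 a.2.1 a.2.2

/-- The degree `r` of `T_{i,j}^{(r)}`. -/
def tDeg (a : TIndex n) : ℕ := a.2.2

/-- The filtration of the Yangian with `T_{i,j}^{(r)}` in degree `r`. -/
noncomputable def tFil (n : ℕ) : ℕ → Submodule ℂ (Yangian n) := wordFil (tFam n) tDeg

theorem isMulFiltration_tFil (n : ℕ) : IsMulFiltration (tFil n) := isMulFiltration_wordFil _ _

theorem T_mem {V : ℕ → Submodule ℂ (Yangian n)} (hV : IsMulFiltration V)
    (h : ∀ a : TIndex n, tFam n a ∈ V (tDeg a)) (i j : Fin n) (r : ℕ) : T n i j r ∈ V r := by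
  rcases r with _ | r
  · rw [T_zero]
    split_ifs
    · exact hV.one_mem
    · exact zero_mem _
  · exact h (i, j, ⟨r + 1, by omega⟩)

theorem T_mem_tFil (i j : Fin n) (r : ℕ) : T n i j r ∈ tFil n r :=
  T_mem (isMulFiltration_tFil n) mem_wordFil i j r

/-- The defining relation moves one unit of degree from the first factor to the second, at the cost
of products of degree one less. The process ends at the scalar $T_{i,j}^{(0)}$. -/
theorem T_commutator_mem (i j h k : Fin n) (r s : ℕ) :
    T n i j r * T n h k s - T n h k s * T n i j r ∈ predFil (tFil n) (r + s) := by
  have hV := isMulFiltration_tFil n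
  induction r generalizing s with
  | zero =>
    rw [T_zero]
    split_ifs
    · rw [one_mul, mul_one, sub_self]; exact zero_mem _
    · rw [zero_mul, mul_zero, sub_self]; exact zero_mem _
  | succ r ih =>
    have h1 := T_rel i j h k r s
    rw [Ring.lie_def, Ring.lie_def, sub_eq_iff_eq_add] at h1
    rw [h1]
    have h2 := ih (s + 1)
    rw [show r + 1 + s = r + s + 1 by omega]
    refine add_mem (sub_mem (hV.mul_mem (T_mem_tFil _ _ _) (T_mem_tFil _ _ _)) ?_) h2
    rw [add_comm r s]
    exact hV.mul_mem (T_mem_tFil _ _ _) (T_mem_tFil _ _ _)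

theorem serIn_Tser {V : ℕ → Submodule ℂ (Yangian n)} (h : ∀ i j r, T n i j r ∈ V r)
    (i j : Fin n) : SerIn V (Tser n i j) := fun r => by
  simpa [Tser] using h i j r

/-- The degree `r` of `D_i^{(r)}`, `E_{i,j}^{(r)}` and `F_{i,j}^{(r)}`. -/
def allDeg : AllIndex n → ℕ
  | Sum.inl a => a.2
  | Sum.inr (Sum.inl a) => a.2
  | Sum.inr (Sum.inr a) => a.2

/-- The letters `T_{i,i}^{(r)}`, `T_{i,j}^{(r)}`, `T_{j,i}^{(r)}` corresponding to `D_i^{(r)}`,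
`E_{i,j}^{(r)}`, `F_{i,j}^{(r)}`. -/
def toTIndex : AllIndex n → TIndex n
  | Sum.inl a => (a.1, a.1, a.2)
  | Sum.inr (Sum.inl a) => (a.1.1.1, a.1.1.2, a.2)
  | Sum.inr (Sum.inr a) => (a.1.1.2, a.1.1.1, a.2)

theorem toTIndex_injective : Function.Injective (toTIndex (n := n)) := by
  rintro (⟨i, r⟩ | ⟨⟨⟨i, j⟩, hij⟩, r⟩ | ⟨⟨⟨i, j⟩, hij⟩, r⟩)
    (⟨i', r'⟩ | ⟨⟨⟨i', j'⟩, hij'⟩, r'⟩ | ⟨⟨⟨i', j'⟩, hij'⟩, r'⟩) h <;>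
  simp only [toTIndex, Prod.mk.injEq] at h <;>
  obtain ⟨h1, h2, h3⟩ := h <;> subst h1 <;> subst h3 <;> (try subst h2) <;>
  first | rfl | exact absurd hij (lt_irrefl _) | exact absurd hij' (lt_irrefl _) |
    exact absurd hij hij'.asymm

theorem tDeg_toTIndex (a : AllIndex n) : tDeg (toTIndex a) = allDeg a := by
  rcases a with a | a | a <;> rfl

theorem allFam_mem_tFil (a : AllIndex n) : allFam n a ∈ tFil n (allDeg a) := by
  have hV := isMulFiltration_tFil n
  have hM := serIn_Tser (T_mem_tFil (n := n))
  rcases a with a | a | a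
  · exact serIn_gaussD hV hM _ _
  · exact serIn_gaussE hV hM _ _ _
  · exact serIn_gaussF hV hM _ _ _

theorem E_zero {i j : Fin n} (h : i < j) : E n i j 0 = 0 := by
  rw [E, gaussE, PowerSeries.coeff_zero_eq_constantCoeff_apply, map_mul,
    constantCoeff_schur _ (constantCoeff_Tser n), if_neg (by rintro ⟨rfl, -⟩; exact lt_irrefl _ h),
    mul_zero]

theorem F_zero {i j : Fin n} (h : i < j) : F n i j 0 = 0 := by
  rw [F, gaussF, PowerSeries.coeff_zero_eq_constantCoeff_apply, map_mul,
    constantCoeff_schur _ (constantCoeff_Tser n), if_neg (by rintro ⟨rfl, -⟩; exact lt_irrefl _ h),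
    zero_mul]

theorem D_zero (i : Fin n) : D n i 0 = 1 := by
  rw [D, gaussD, PowerSeries.coeff_zero_eq_constantCoeff_apply,
    constantCoeff_schur _ (constantCoeff_Tser n), if_pos ⟨rfl, le_rfl⟩]

theorem T_mem_of_allFam_mem {V : ℕ → Submodule ℂ (Yangian n)} (hV : IsMulFiltration V)
    (h : ∀ a, allFam n a ∈ V (allDeg a)) (i j : Fin n) (r : ℕ) : T n i j r ∈ V r := by
  have hD : ∀ i, SerIn V (PowerSeries.mk (D n i)) := by
    intro i r
    rw [PowerSeries.coeff_mk]
    rcases r with _ | r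
    · rw [D_zero]; exact hV.one_mem
    · exact h (Sum.inl (i, ⟨r + 1, by omega⟩))
  have hE : ∀ i j, i < j → SerIn V (PowerSeries.mk (E n i j)) := by
    intro i j hij r
    rw [PowerSeries.coeff_mk]
    rcases r with _ | r
    · rw [E_zero hij]; exact zero_mem _
    · exact h (Sum.inr (Sum.inl (⟨(i, j), hij⟩, ⟨r + 1, by omega⟩)))
  have hF : ∀ i j, i < j → SerIn V (PowerSeries.mk (F n i j)) := by
    intro i j hij r
    rw [PowerSeries.coeff_mk]
    rcases r with _ | r
    · rw [F_zero hij]; exact zero_mem _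
    · exact h (Sum.inr (Sum.inr (⟨(i, j), hij⟩, ⟨r + 1, by omega⟩)))
  have key : SerIn V (Tser n i j) := by
    rw [Tser_eq, Matrix.mul_apply]
    refine SerIn.sum fun l _ => ?_
    rw [diagMat, Matrix.mul_diagonal]
    refine SerIn.mul hV (SerIn.mul hV ?_ (hD l)) ?_
    · simp only [lowerMat, Matrix.of_apply]
      split_ifs with h1 h2
      · exact hF _ _ h1
      · exact SerIn.one hV
      · exact SerIn.zero
    · simp only [upperMat, Matrix.of_apply]
      split_ifs with h1 h2
      · exact hE _ _ h1
      · exact SerIn.one hV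
      · exact SerIn.zero
  simpa [Tser] using key r

theorem eq_top_of_T_mem (P : Subalgebra ℂ (Yangian n)) (h : ∀ i j r, T n i j r ∈ P) : P = ⊤ := by
  rw [eq_top_iff]
  intro y _
  obtain ⟨z, rfl⟩ := RingQuot.mkAlgHom_surjective ℂ (Rel n) y
  have hz : z ∈ Algebra.adjoin ℂ (Set.range (FreeAlgebra.ι ℂ)) := by
    rw [FreeAlgebra.adjoin_range_ι]; trivial
  have : Algebra.adjoin ℂ (Set.range (FreeAlgebra.ι ℂ)) ≤ P.comap (RingQuot.mkAlgHom ℂ (Rel n)) := by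
    refine Algebra.adjoin_le ?_
    rintro _ ⟨⟨i, j, r⟩, rfl⟩
    have := h i j r
    rw [T, freeT, dif_pos r.pos] at this
    exact this
  exact this hz

end YangianFiltration

/-! ### Finiteness of words of bounded degree -/

theorem finite_wdeg_le {I : Type*} {deg : I → ℕ} (hpos : ∀ a, 1 ≤ deg a)
    (hfin : ∀ d, {a | deg a ≤ d}.Finite) (d : ℕ) : {w : List I | wdeg deg w ≤ d}.Finite := by
  induction d with
  | zero =>
    refine (Set.finite_singleton []).subset fun w hw => ?_
    rcases w with _ | ⟨a, w⟩
    · rfl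
    · have := hpos a
      rw [Set.mem_ofPred_eq, wdeg_cons] at hw
      omega
  | succ d ih =>
    refine ((Set.finite_singleton []).union
      (Set.Finite.image2 List.cons (hfin (d + 1)) ih)).subset fun w hw => ?_
    rcases w with _ | ⟨a, w⟩
    · exact Or.inl rfl
    · have := hpos a
      rw [Set.mem_ofPred_eq, wdeg_cons] at hw
      exact Or.inr ⟨a, by simp; omega, w, by simp; omega, rfl⟩

/-! ### Bases of ordered monomials -/

section OrderedBases

variable {n : ℕ} {J : Type*} (g : J ≃ AllIndex n)

/-- Passing from $T(u)$ to $F(u),D(u),E(u)$ and back uses only products, sums and inverses of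
series, which keep the $r$-th coefficient in degree $r$. -/
theorem wordFil_allFam (d : ℕ) : wordFil (fun a => allFam n (g a)) (fun a => allDeg (g a)) d =
    tFil n d := by
  apply le_antisymm
  · exact wordFil_le (isMulFiltration_tFil n) (fun a => allFam_mem_tFil (g a)) d
  · have hV := isMulFiltration_wordFil (fun a => allFam n (g a)) (fun a => allDeg (g a))
    refine wordFil_le hV (fun a => T_mem_of_allFam_mem hV (fun b => ?_) _ _ _) d
    have := mem_wordFil (x := fun a => allFam n (g a)) (deg := fun a => allDeg (g a)) (g.symm b)
    simpa using this

theorem allFam_commutator_mem (a b : J) :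
    allFam n (g a) * allFam n (g b) - allFam n (g b) * allFam n (g a) ∈
      predFil (wordFil (fun a => allFam n (g a)) (fun a => allDeg (g a)))
        (allDeg (g a) + allDeg (g b)) := by
  rw [show wordFil (fun a => allFam n (g a)) (fun a => allDeg (g a)) = tFil n from
    funext (wordFil_allFam g)]
  exact wordFil_commutator_mem (fun a b => T_commutator_mem _ _ _ _ _ _) (allFam_mem_tFil (g a))
    (allFam_mem_tFil (g b))

theorem finite_allDeg_le (d : ℕ) : {a | allDeg (g a) ≤ d}.Finite := by
  have h1 : {a : TIndex n | tDeg a ≤ d}.Finite := by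
    have h2 : {r : ℕ+ | (r : ℕ) ≤ d}.Finite :=
      (Set.finite_Iic d).preimage (PNat.coe_injective.injOn)
    refine ((Set.finite_univ (α := Fin n)).prod ((Set.finite_univ (α := Fin n)).prod h2)).subset ?_
    rintro ⟨i, j, r⟩ h
    exact ⟨trivial, trivial, h⟩
  have h3 := h1.preimage ((toTIndex_injective.comp g.injective).injOn)
  refine h3.subset fun a ha => ?_
  simpa [tDeg_toTIndex] using ha

theorem one_le_allDeg (a : AllIndex n) : 1 ≤ allDeg a := by
  rcases a with a | a | a <;> exact a.2.pos

variable (le : J → J → Prop) [hle : IsLinearOrder J le]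

theorem linearIndependent_ordered_tWord :
    LinearIndependent ℂ fun w : OrderedWord le =>
      (w.1.map fun a => tFam n (toTIndex (g a))).prod := by
  have := linearIndependent_tWord (AlgEquiv.refl : Yangian n ≃ₐ[ℂ] Yangian n)
    (fun w : OrderedWord le => w.1.map fun a => toTIndex (g a)) (by
      intro w w' h
      have h' := (List.map_perm_map_iff (toTIndex_injective.comp g.injective)).1 h
      exact Subtype.ext (h'.eq_of_pairwise
        (fun a b _ _ hab hba => hle.antisymm a b hab hba) w.2 w'.2))
  have h : (fun w : OrderedWord le => (w.1.map fun a => tFam n (toTIndex (g a))).prod) =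
      fun w => tWord (AlgEquiv.refl : Yangian n ≃ₐ[ℂ] Yangian n)
        (w.1.map fun a => toTIndex (g a)) := by
    funext w
    rw [tWord, List.map_map]
    rfl
  rw [h]
  exact this

/-- Ordered monomials in the `D`, `E` and `F` generators are linearly independent. -/
theorem linearIndependent_allFam :
    LinearIndependent ℂ fun w : OrderedWord le => (w.1.map fun a => allFam n (g a)).prod := by
  rw [linearIndependent_iff_finset_linearIndependent]
  intro s
  let d := s.sup fun w => wdeg (fun a => allDeg (g a)) w.1
  -- The same finite set indexes the ordered words in both families, since `toTIndex` preserves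
  -- degree.
  let W := {w : OrderedWord le // wdeg (fun a => allDeg (g a)) w.1 ≤ d}
  let v : W → Yangian n := fun w => (w.1.1.map fun a => allFam n (g a)).prod
  let t : W → Yangian n := fun w => (w.1.1.map fun a => tFam n (toTIndex (g a))).prod
  suffices hv : LinearIndependent ℂ v by
    exact hv.comp (fun w : s => (⟨w.1, Finset.le_sup (f := fun w : OrderedWord le =>
      wdeg (fun a => allDeg (g a)) w.1) w.2⟩ : W))
      fun w w' h => Subtype.ext (congrArg (fun x : W => x.1) h)
  have hfin : Finite W := by
    have := finite_wdeg_le (fun a => one_le_allDeg (g a)) (finite_allDeg_le g) d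
    have : Finite {w : List J | wdeg (fun a => allDeg (g a)) w ≤ d} := this
    exact Finite.of_injective (fun w : W => (⟨w.1.1, w.2⟩ :
      {w : List J | wdeg (fun a => allDeg (g a)) w ≤ d}))
      fun w w' h => Subtype.ext (Subtype.ext (Subtype.mk.inj h))
  have := Fintype.ofFinite W
  have hspan : Submodule.span ℂ (Set.range v) = tFil n d := by
    apply le_antisymm
    · refine Submodule.span_le.2 ?_
      rintro _ ⟨w, rfl⟩
      rw [← wordFil_allFam g d]
      exact prod_mem_wordFil w.2
    · rw [← wordFil_allFam g d]
      refine (wordFil_le_span_ordered (allFam_commutator_mem g) le d).trans ?_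
      refine Submodule.span_mono ?_
      rintro _ ⟨w, hw, rfl⟩
      exact ⟨⟨w, hw⟩, rfl⟩
  have ht : LinearIndependent ℂ t :=
    (linearIndependent_ordered_tWord g le).comp (fun w : W => w.1) Subtype.val_injective
  have htm : ∀ w, t w ∈ Submodule.span ℂ (Set.range v) := by
    intro w
    rw [hspan]
    have h1 : t w = ((w.1.1.map fun a => toTIndex (g a)).map (tFam n)).prod := by
      simp only [t, List.map_map]; rfl
    rw [h1]
    refine prod_mem_wordFil ?_
    have h2 := w.2
    unfold wdeg at h2 ⊢
    rw [List.map_map]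
    simpa only [Function.comp_def, tDeg_toTIndex] using h2
  -- The span of $v$ contains the independent family $t$ on the same index set, so its dimension is
  -- the number of indices.
  rw [linearIndependent_iff_card_eq_finrank_span]
  refine le_antisymm ?_ (finrank_range_le_card v)
  have : Module.Finite ℂ (Submodule.span ℂ (Set.range v)) :=
    Module.Finite.span_of_finite ℂ (Set.finite_range v)
  have ht' : LinearIndependent ℂ (fun w => (⟨t w, htm w⟩ : Submodule.span ℂ (Set.range v))) :=
    LinearIndependent.of_comp (Submodule.span ℂ (Set.range v)).subtype ht
  exact ht'.fintype_card_le_finrank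

theorem span_allFam :
    Submodule.span ℂ (Set.range fun w : OrderedWord le =>
      (w.1.map fun a => allFam n (g a)).prod) = ⊤ := by
  rw [span_ordered_eq_adjoin (allFam_commutator_mem g) le]
  have : Algebra.adjoin ℂ (Set.range fun a => allFam n (g a)) = ⊤ := by
    set P := Algebra.adjoin ℂ (Set.range fun a => allFam n (g a))
    refine eq_top_of_T_mem _ fun i j r => ?_
    refine T_mem_of_allFam_mem (V := fun _ => Subalgebra.toSubmodule P)
      ⟨one_mem P, fun hx hy => P.mul_mem hx hy, fun _ _ _ => le_rfl⟩ (fun b => ?_) i j r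
    exact Algebra.subset_adjoin ⟨g.symm b, by simp⟩
  rw [this, Algebra.top_toSubmodule]

end OrderedBases

end Yangian

namespace Yangian

/-! ### Passing to the opposite algebra -/

section Opposite

open MulOpposite

variable {R : Type*} [Ring R]

/-- The coefficientwise image of a power series in the opposite ring. -/
noncomputable def opSer (f : PowerSeries R) : PowerSeries Rᵐᵒᵖ :=
  PowerSeries.mk fun r => op (PowerSeries.coeff r f)

theorem coeff_opSer (r : ℕ) (f : PowerSeries R) :
    PowerSeries.coeff r (opSer f) = op (PowerSeries.coeff r f) := PowerSeries.coeff_mk _ _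

theorem opSer_sub (f g : PowerSeries R) : opSer (f - g) = opSer f - opSer g := by
  ext r; simp [coeff_opSer]

theorem opSer_one : opSer (1 : PowerSeries R) = 1 := by
  ext r
  rw [coeff_opSer, PowerSeries.coeff_one, PowerSeries.coeff_one]
  split_ifs <;> simp

theorem opSer_mul (f g : PowerSeries R) : opSer (f * g) = opSer g * opSer f := by
  ext r
  rw [coeff_opSer, PowerSeries.coeff_mul, PowerSeries.coeff_mul,
    ← Finset.Nat.sum_antidiagonal_swap, Finset.op_sum]
  simp [coeff_opSer]

theorem constantCoeff_opSer (f : PowerSeries R) :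
    PowerSeries.constantCoeff (opSer f) = op (PowerSeries.constantCoeff f) := by
  rw [← PowerSeries.coeff_zero_eq_constantCoeff_apply, coeff_opSer,
    PowerSeries.coeff_zero_eq_constantCoeff_apply]

theorem opSer_invSer (f : PowerSeries R) (hf : PowerSeries.constantCoeff f = 1) :
    opSer (invSer f) = invSer (opSer f) := by
  have h1 : opSer (invSer f) * opSer f = 1 := by
    rw [← opSer_mul, invSer, PowerSeries.mul_invOfUnit _ _ (by simpa using hf), opSer_one]
  have h2 : opSer f * invSer (opSer f) = 1 :=
    PowerSeries.mul_invOfUnit _ _ (by rw [constantCoeff_opSer, hf]; simp)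
  exact left_inv_eq_right_inv h1 h2

variable {n : ℕ} (M : Matrix (Fin n) (Fin n) (PowerSeries R))

/-- The transposed matrix over the opposite ring. -/
noncomputable def opMat : Matrix (Fin n) (Fin n) (PowerSeries Rᵐᵒᵖ) :=
  Matrix.of fun i j => opSer (M j i)

/-- Reversing products changes the sign of the commutators; transposing indices changes the sign of
the right-hand side in the same way. -/
theorem isRTT_opMat (H : IsRTT M) : IsRTT (opMat M) := by
  intro i j h k r s
  have := congrArg op (H j i k h r s)
  simp only [opMat, Matrix.of_apply, coeff_opSer, Ring.lie_def, op_sub, op_mul] at this ⊢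
  linear_combination (norm := abel) -this

variable {M}
variable (hM : ∀ i j, PowerSeries.constantCoeff (M i j) = if i = j then 1 else 0)

include hM

theorem constantCoeff_opMat (i j : Fin n) :
    PowerSeries.constantCoeff (opMat M i j) = if i = j then 1 else 0 := by
  rw [opMat, Matrix.of_apply, constantCoeff_opSer, hM]
  by_cases h : i = j
  · simp [h]
  · simp [h, Ne.symm h]

theorem schur_opMat (k : ℕ) (i j : Fin n) : schur (opMat M) k i j = opSer (schur M k j i) := by
  induction k generalizing i j with
  | zero => rfl
  | succ k ih =>
    simp only [schur, Matrix.of_apply]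
    split_ifs with hk
    · rw [ih, ih, ih, ih, opSer_sub, opSer_mul, opSer_mul, opSer_invSer, mul_assoc]
      rw [constantCoeff_schur M hM]
      simp
    · exact ih i j

/-- This exchange of $E$ and $F$ transports the results on upper Gauss coefficients to lower ones.
-/
theorem gaussE_opMat (i j : Fin n) : gaussE (opMat M) i j = opSer (gaussF M i j) := by
  rw [gaussE, gaussF, gaussD, schur_opMat hM, schur_opMat hM, opSer_mul, opSer_invSer]
  · rfl
  · rw [gaussD, constantCoeff_schur M hM]
    simp

variable [Algebra ℂ R] (H : IsRTT M)

include H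

/-- The lower Gauss coefficients commute up to lower terms, in any multiplicative filtration. -/
theorem gaussF_commutator_mem {V : ℕ → Submodule ℂ R} (hV : IsMulFiltration V)
    (hF : ∀ i j, i < j → ∀ r, PowerSeries.coeff r (gaussF M i j) ∈ V r)
    (i j h k : Fin n) (r s : ℕ) :
    PowerSeries.coeff r (gaussF M i j) * PowerSeries.coeff s (gaussF M h k) -
      PowerSeries.coeff s (gaussF M h k) * PowerSeries.coeff r (gaussF M i j) ∈
        predFil V (r + s) := by
  let V' : ℕ → Submodule ℂ Rᵐᵒᵖ := fun d =>
    (V d).comap (opLinearEquiv ℂ : R ≃ₗ[ℂ] Rᵐᵒᵖ).symm.toLinearMap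
  have hV' : IsMulFiltration V' :=
    ⟨hV.one_mem, fun {a b x y} hx hy => by
      have := hV.mul_mem hy hx
      rw [add_comm] at this
      exact this, fun a b hab x hx => hV.mono hab hx⟩
  have key := gaussE_commutator_mem (M := opMat M) (constantCoeff_opMat hM) (isRTT_opMat M H) hV'
    (fun i j hij r => by
      rw [gaussE_opMat hM, coeff_opSer]
      exact hF i j hij r) h k i j s r
  simp only [gaussE_opMat hM, coeff_opSer, ← op_mul, ← op_sub] at key
  rw [add_comm s r] at key
  generalize r + s = d at key ⊢
  rcases d with _ | d
  · exact op_injective key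
  · exact key

/-- A subalgebra containing the coefficients of all `F_{i,i+1}(u)` contains those of all
`F_{i,j}(u)`. -/
theorem coeff_gaussF_mem_subalgebra (P : Subalgebra ℂ R)
    (hP : ∀ i j : Fin n, j.1 = i.1 + 1 → ∀ r, PowerSeries.coeff r (gaussF M i j) ∈ P)
    (i j : Fin n) (hij : i < j) (r : ℕ) : PowerSeries.coeff r (gaussF M i j) ∈ P := by
  have := coeff_gaussE_mem_subalgebra (M := opMat M) (constantCoeff_opMat hM) (isRTT_opMat M H) P.op
    (fun i j hij r => by
      rw [gaussE_opMat hM, coeff_opSer]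
      exact hP i j hij r) i j hij r
  rw [gaussE_opMat hM, coeff_opSer] at this
  exact this

end Opposite

/-! ### The three subalgebras as spans of ordered monomials -/

section Subalgebras

variable {n : ℕ}

theorem span_dFam (le : DIndex n → DIndex n → Prop) [IsLinearOrder (DIndex n) le] :
    Submodule.span ℂ (Set.range fun w : OrderedWord le => (w.1.map (dFam n)).prod) =
      Subalgebra.toSubmodule (cartan n) := by
  -- With all degrees $0$, straightening requires commutators to vanish exactly, which holds for the
  -- $D_i^{(r)}$.
  rw [span_ordered_eq_adjoin (deg := fun _ => 0) (x := dFam n) (fun a b => ?_) le]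
  · congr 2
    ext x
    constructor
    · rintro ⟨a, rfl⟩
      exact ⟨a.1, a.2, a.2.pos, rfl⟩
    · rintro ⟨i, r, hr, rfl⟩
      exact ⟨(i, ⟨r, hr⟩), rfl⟩
  · have := (commute_gaussD (constantCoeff_Tser n) (isRTT_Tser n) a.1 b.1 a.2 b.2).eq
    rw [show dFam n a * dFam n b = dFam n b * dFam n a from this, sub_self]
    exact zero_mem _

theorem span_eFam (le : RootIndex n → RootIndex n → Prop) [IsLinearOrder (RootIndex n) le] :
    Submodule.span ℂ (Set.range fun w : OrderedWord le => (w.1.map (eFam n)).prod) =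
      Subalgebra.toSubmodule (plus n) := by
  rw [span_ordered_eq_adjoin (deg := fun a => (a.2 : ℕ)) (x := eFam n) (fun a b => ?_) le]
  · congr 1
    apply le_antisymm
    · refine Algebra.adjoin_le ?_
      rintro _ ⟨a, rfl⟩
      refine coeff_gaussE_mem_subalgebra (constantCoeff_Tser n) (isRTT_Tser n) (plus n) ?_
        a.1.1.1 a.1.1.2 a.1.2 a.2
      intro i j hij r
      rcases r with _ | r
      · have := E_zero (n := n) (i := i) (j := j) (by rw [Fin.lt_def]; omega)
        rw [E] at this
        rw [this]
        exact zero_mem _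
      · exact Algebra.subset_adjoin ⟨i, j, r + 1, hij, by omega, rfl⟩
    · refine Algebra.adjoin_mono ?_
      rintro _ ⟨i, j, r, hij, hr, rfl⟩
      exact ⟨(⟨(i, j), by rw [Fin.lt_def]; simp only; omega⟩, ⟨r, hr⟩), rfl⟩
  · refine gaussE_commutator_mem (constantCoeff_Tser n) (isRTT_Tser n)
      (isMulFiltration_wordFil _ _) ?_ _ _ _ _ _ _
    intro i j hij r
    rcases r with _ | r
    · have := E_zero (n := n) hij
      rw [E] at this
      rw [this]
      exact zero_mem _
    · exact mem_wordFil (x := eFam n) (deg := fun a => (a.2 : ℕ))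
        (⟨(i, j), hij⟩, ⟨r + 1, by omega⟩)

theorem span_fFam (le : RootIndex n → RootIndex n → Prop) [IsLinearOrder (RootIndex n) le] :
    Submodule.span ℂ (Set.range fun w : OrderedWord le => (w.1.map (fFam n)).prod) =
      Subalgebra.toSubmodule (minus n) := by
  rw [span_ordered_eq_adjoin (deg := fun a => (a.2 : ℕ)) (x := fFam n) (fun a b => ?_) le]
  · congr 1
    apply le_antisymm
    · refine Algebra.adjoin_le ?_
      rintro _ ⟨a, rfl⟩
      refine coeff_gaussF_mem_subalgebra (constantCoeff_Tser n) (isRTT_Tser n) (minus n) ?_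
        a.1.1.1 a.1.1.2 a.1.2 a.2
      intro i j hij r
      rcases r with _ | r
      · have := F_zero (n := n) (i := i) (j := j) (by rw [Fin.lt_def]; omega)
        rw [F] at this
        rw [this]
        exact zero_mem _
      · exact Algebra.subset_adjoin ⟨i, j, r + 1, hij, by omega, rfl⟩
    · refine Algebra.adjoin_mono ?_
      rintro _ ⟨i, j, r, hij, hr, rfl⟩
      exact ⟨(⟨(i, j), by rw [Fin.lt_def]; simp only; omega⟩, ⟨r, hr⟩), rfl⟩
  · refine gaussF_commutator_mem (constantCoeff_Tser n) (isRTT_Tser n)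
      (isMulFiltration_wordFil _ _) ?_ _ _ _ _ _ _
    intro i j hij r
    rcases r with _ | r
    · have := F_zero (n := n) hij
      rw [F] at this
      rw [this]
      exact zero_mem _
    · exact mem_wordFil (x := fFam n) (deg := fun a => (a.2 : ℕ))
        (⟨(i, j), hij⟩, ⟨r + 1, by omega⟩)

end Subalgebras

end Yangian

namespace Yangian

/-! ### Lexicographic sums of linear orders and ordered words -/

section Lex

variable {I J : Type*} (r : I → I → Prop) (s : J → J → Prop)

theorem isLinearOrder_lex [hr : IsLinearOrder I r] [hs : IsLinearOrder J s] :
    IsLinearOrder (I ⊕ J) (Sum.Lex r s) where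
  refl
    | Sum.inl a => Sum.Lex.inl (hr.refl a)
    | Sum.inr a => Sum.Lex.inr (hs.refl a)
  trans := by
    rintro _ _ _ (h | h | ⟨a, b⟩) (h' | h' | ⟨a', b'⟩)
    · exact Sum.Lex.inl (hr.trans _ _ _ h h')
    · exact Sum.Lex.sep _ _
    · exact Sum.Lex.inr (hs.trans _ _ _ h h')
    · exact Sum.Lex.sep _ _
  antisymm := by
    rintro _ _ (h | h | ⟨a, b⟩) (h' | h' | ⟨a', b'⟩)
    · rw [hr.antisymm _ _ h h']
    · rw [hs.antisymm _ _ h h']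
  total
    | Sum.inl a, Sum.inl b => (hr.total a b).imp Sum.Lex.inl Sum.Lex.inl
    | Sum.inl a, Sum.inr b => Or.inl (Sum.Lex.sep a b)
    | Sum.inr a, Sum.inl b => Or.inr (Sum.Lex.sep b a)
    | Sum.inr a, Sum.inr b => (hs.total a b).imp Sum.Lex.inr Sum.Lex.inr

theorem exists_isLinearOrder (I : Type*) : ∃ r : I → I → Prop, IsLinearOrder I r := by
  let _ : LinearOrder I := WellOrderingRel.isWellOrder.linearOrder
  exact ⟨(· ≤ ·), inferInstance⟩

/-- Concatenation of ordered words. -/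
def concatWord (p : OrderedWord r × OrderedWord s) : OrderedWord (Sum.Lex r s) :=
  ⟨p.1.1.map Sum.inl ++ p.2.1.map Sum.inr, by
    rw [List.pairwise_append]
    refine ⟨p.1.2.map _ fun _ _ h => Sum.Lex.inl h, p.2.2.map _ fun _ _ h => Sum.Lex.inr h, ?_⟩
    intro a ha b hb
    obtain ⟨a, -, rfl⟩ := List.mem_map.1 ha
    obtain ⟨b, -, rfl⟩ := List.mem_map.1 hb
    exact Sum.Lex.sep a b⟩

theorem concatWord_injective : Function.Injective (concatWord r s) := by
  rintro ⟨⟨u, hu⟩, ⟨v, hv⟩⟩ ⟨⟨u', hu'⟩, ⟨v', hv'⟩⟩ h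
  have h1 : u.map Sum.inl ++ v.map Sum.inr = u'.map Sum.inl ++ v'.map Sum.inr :=
    congrArg Subtype.val h
  have h2 := congrArg (List.filterMap Sum.getLeft?) h1
  have h3 := congrArg (List.filterMap Sum.getRight?) h1
  simp [List.filterMap_append, List.filterMap_map, Function.comp_def] at h2 h3
  simp [h2, h3]

/-- In the lexicographic sum no left letter may follow a right letter, so every ordered word splits
into two blocks. -/
theorem concatWord_surjective : Function.Surjective (concatWord r s) := by
  have key : ∀ w : List (I ⊕ J), w.Pairwise (Sum.Lex r s) →
      ∃ (u : List I) (v : List J), u.Pairwise r ∧ v.Pairwise s ∧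
        w = u.map Sum.inl ++ v.map Sum.inr := by
    intro w
    induction w with
    | nil => exact fun _ => ⟨[], [], List.Pairwise.nil, List.Pairwise.nil, rfl⟩
    | cons a w ih =>
      intro hw
      rw [List.pairwise_cons] at hw
      obtain ⟨u, v, hu, hv, rfl⟩ := ih hw.2
      rcases a with a | b
      · refine ⟨a :: u, v, List.pairwise_cons.2 ⟨fun a' ha' => ?_, hu⟩, hv, rfl⟩
        exact Sum.lex_inl_inl.1 (hw.1 _ (List.mem_append_left _ (List.mem_map_of_mem ha')))
      · have hu0 : u = [] := by
          refine List.eq_nil_iff_forall_not_mem.2 fun a' ha' => ?_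
          exact Sum.lex_inr_inl (hw.1 _ (List.mem_append_left _ (List.mem_map_of_mem ha')))
        subst hu0
        refine ⟨[], b :: v, List.Pairwise.nil, List.pairwise_cons.2 ⟨fun b' hb' => ?_, hv⟩, rfl⟩
        exact Sum.lex_inr_inr.1 (hw.1 _ (List.mem_append_right _ (List.mem_map_of_mem hb')))
  rintro ⟨w, hw⟩
  obtain ⟨u, v, hu, hv, rfl⟩ := key w hw
  exact ⟨(⟨u, hu⟩, ⟨v, hv⟩), rfl⟩

end Lex

/-! ### The triangular order and its consequences -/

section Triangular

variable {n : ℕ}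

/-- The index set of all generators, in the order `F`, `D`, `E`. -/
abbrev TriIndex (n : ℕ) : Type := RootIndex n ⊕ (DIndex n ⊕ RootIndex n)

/-- Rearranging the three kinds of generators. -/
def triEquiv (n : ℕ) : TriIndex n ≃ AllIndex n :=
  (Equiv.sumComm _ _).trans (Equiv.sumAssoc _ _ _)

/-- Concatenation of ordered words in the `F`, `D` and `E` generators. -/
def triWord {lF : RootIndex n → RootIndex n → Prop} {lD : DIndex n → DIndex n → Prop}
    {lE : RootIndex n → RootIndex n → Prop}
    (p : (OrderedWord lF × OrderedWord lD) × OrderedWord lE) :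
    OrderedWord (Sum.Lex lF (Sum.Lex lD lE)) :=
  concatWord lF _ (p.1.1, concatWord lD lE (p.1.2, p.2))

theorem triWord_bijective (lF : RootIndex n → RootIndex n → Prop)
    (lD : DIndex n → DIndex n → Prop) (lE : RootIndex n → RootIndex n → Prop) :
    Function.Bijective (triWord (lF := lF) (lD := lD) (lE := lE)) := by
  constructor
  · rintro ⟨⟨f, d⟩, e⟩ ⟨⟨f', d'⟩, e'⟩ h
    have h1 := concatWord_injective _ _ h
    have h2 := concatWord_injective _ _ (congrArg Prod.snd h1)
    rw [Prod.ext_iff] at h1 h2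
    simp only at h1 h2
    rw [h1.1, h2.1, h2.2]
  · intro w
    obtain ⟨⟨f, w'⟩, rfl⟩ := concatWord_surjective _ _ w
    obtain ⟨⟨d, e⟩, rfl⟩ := concatWord_surjective _ _ w'
    exact ⟨((f, d), e), rfl⟩

theorem prod_triWord {lF : RootIndex n → RootIndex n → Prop} {lD : DIndex n → DIndex n → Prop}
    {lE : RootIndex n → RootIndex n → Prop}
    (p : (OrderedWord lF × OrderedWord lD) × OrderedWord lE) :
    ((triWord p).1.map fun a => allFam n (triEquiv n a)).prod =
      (p.1.1.1.map (fFam n)).prod * (p.1.2.1.map (dFam n)).prod * (p.2.1.map (eFam n)).prod := by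
  simp only [triWord, concatWord, List.map_append, List.map_map, List.prod_append, mul_assoc]
  rfl

variable (lF : RootIndex n → RootIndex n → Prop) (lD : DIndex n → DIndex n → Prop)
  (lE : RootIndex n → RootIndex n → Prop) [hF : IsLinearOrder (RootIndex n) lF]
  [hD : IsLinearOrder (DIndex n) lD] [hE : IsLinearOrder (RootIndex n) lE]

include hF hD hE

theorem linearIndependent_triple :
    LinearIndependent ℂ fun p : (OrderedWord lF × OrderedWord lD) × OrderedWord lE =>
      (p.1.1.1.map (fFam n)).prod * (p.1.2.1.map (dFam n)).prod * (p.2.1.map (eFam n)).prod := by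
  have := isLinearOrder_lex lD lE
  have := isLinearOrder_lex lF (Sum.Lex lD lE)
  have h := (linearIndependent_allFam (triEquiv n) (Sum.Lex lF (Sum.Lex lD lE))).comp _
    (triWord_bijective lF lD lE).1
  simpa only [Function.comp_def, prod_triWord] using h

theorem span_triple :
    Submodule.span ℂ (Set.range fun p : (OrderedWord lF × OrderedWord lD) × OrderedWord lE =>
      (p.1.1.1.map (fFam n)).prod * (p.1.2.1.map (dFam n)).prod *
        (p.2.1.map (eFam n)).prod) = ⊤ := by
  have := isLinearOrder_lex lD lE
  have := isLinearOrder_lex lF (Sum.Lex lD lE)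
  have h := span_allFam (triEquiv n) (Sum.Lex lF (Sum.Lex lD lE))
  rw [← (triWord_bijective lF lD lE).2.range_comp] at h
  simpa only [Function.comp_def, prod_triWord] using h

end Triangular

/-! ### The four bases and the triangular decomposition -/

section Final

variable {n : ℕ}

/-- The empty word. -/
def emptyWord {I : Type*} (le : I → I → Prop) : OrderedWord le := ⟨[], List.Pairwise.nil⟩

/-- Independence is that of the triples whose $F$ and $E$ words are empty; the order on the root
generators is auxiliary. -/
theorem basis_dFam (le : DIndex n → DIndex n → Prop) [IsLinearOrder (DIndex n) le] :
    OrderedMonomialsFormBasis (dFam n) le (cartan n) := by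
  obtain ⟨r, hr⟩ := exists_isLinearOrder (RootIndex n)
  refine orderedMonomialsFormBasis_of ?_ (span_dFam le)
  have h := (linearIndependent_triple r le r).comp (fun w => ((emptyWord r, w), emptyWord r))
    (fun w w' h => by simpa using h)
  simpa [Function.comp_def, emptyWord] using h

theorem basis_eFam (le : RootIndex n → RootIndex n → Prop) [IsLinearOrder (RootIndex n) le] :
    OrderedMonomialsFormBasis (eFam n) le (plus n) := by
  obtain ⟨r, hr⟩ := exists_isLinearOrder (DIndex n)
  refine orderedMonomialsFormBasis_of ?_ (span_eFam le)
  have h := (linearIndependent_triple le r le).comp (fun w => ((emptyWord le, emptyWord r), w))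
    (fun w w' h => by simpa using h)
  simpa [Function.comp_def, emptyWord] using h

theorem basis_fFam (le : RootIndex n → RootIndex n → Prop) [IsLinearOrder (RootIndex n) le] :
    OrderedMonomialsFormBasis (fFam n) le (minus n) := by
  obtain ⟨r, hr⟩ := exists_isLinearOrder (DIndex n)
  refine orderedMonomialsFormBasis_of ?_ (span_fFam le)
  have h := (linearIndependent_triple le r le).comp (fun w => ((w, emptyWord r), emptyWord le))
    (fun w w' h => by simpa using h)
  simpa [Function.comp_def, emptyWord] using h

theorem basis_allFam (le : AllIndex n → AllIndex n → Prop) [IsLinearOrder (AllIndex n) le] :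
    OrderedMonomialsFormBasis (allFam n) le ⊤ :=
  orderedMonomialsFormBasis_of (linearIndependent_allFam (Equiv.refl _) le)
    ((span_allFam (Equiv.refl _) le).trans Algebra.top_toSubmodule.symm)

/-- The map sends the tensor product of the three monomial bases, index by index, to the basis of
$Y_n$ for the order $F<D<E$. -/
theorem triangularMul_bijective (n : ℕ) : Function.Bijective (triangularMul n) := by
  obtain ⟨rD, hD⟩ := exists_isLinearOrder (DIndex n)
  obtain ⟨rE, hE⟩ := exists_isLinearOrder (RootIndex n)
  obtain ⟨bF, hbF⟩ := basis_fFam (n := n) rE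
  obtain ⟨bD, hbD⟩ := basis_dFam (n := n) rD
  obtain ⟨bE, hbE⟩ := basis_eFam (n := n) rE
  let b := (bF.tensorProduct bD).tensorProduct bE
  let c := Module.Basis.mk (linearIndependent_triple (n := n) rE rD rE)
    (span_triple (n := n) rE rD rE).ge
  have h : triangularMul n = (b.equiv c (Equiv.refl _)).toLinearMap := by
    refine b.ext fun p => ?_
    obtain ⟨⟨f, d⟩, e⟩ := p
    have h1 : b ((f, d), e) = (bF f ⊗ₜ bD d) ⊗ₜ bE e := by
      simp [b, Module.Basis.tensorProduct_apply]
    rw [LinearEquiv.coe_coe, Module.Basis.equiv_apply, h1, triangularMul_tmul, hbF, hbD, hbE]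
    simp [c]
  rw [h]
  exact (b.equiv c (Equiv.refl _)).bijective

end Final

end Yangian

theorem theorem5p10 (n : ℕ) :
    (∀ le : Yangian.DIndex n → Yangian.DIndex n → Prop,
      IsLinearOrder (Yangian.DIndex n) le →
      Yangian.OrderedMonomialsFormBasis (Yangian.dFam n) le (Yangian.cartan n)) ∧
    (∀ le : Yangian.RootIndex n → Yangian.RootIndex n → Prop,
      IsLinearOrder (Yangian.RootIndex n) le →
      Yangian.OrderedMonomialsFormBasis (Yangian.eFam n) le (Yangian.plus n)) ∧
    (∀ le : Yangian.RootIndex n → Yangian.RootIndex n → Prop,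
      IsLinearOrder (Yangian.RootIndex n) le →
      Yangian.OrderedMonomialsFormBasis (Yangian.fFam n) le (Yangian.minus n)) ∧
    (∀ le : Yangian.AllIndex n → Yangian.AllIndex n → Prop,
      IsLinearOrder (Yangian.AllIndex n) le →
      Yangian.OrderedMonomialsFormBasis (Yangian.allFam n) le (⊤ : Subalgebra ℂ (Yangian n))) ∧
    Function.Bijective (Yangian.triangularMul n) :=
  ⟨fun le _ => Yangian.basis_dFam le, fun le _ => Yangian.basis_eFam le,
    fun le _ => Yangian.basis_fFam le, fun le _ => Yangian.basis_allFam le,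
    Yangian.triangularMul_bijective n⟩
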